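/- Let $H\in(1/2,1)$. Let $\{Y(t)\}_{t\in\mathbf Z}$ be a real second-order stationary process with spectral density $h$ in normalised frequency, i.e. $\operatorname{Cov}(Y(t),Y(t+k))=\int_{-1/2}^{1/2}e^{2\pi i k x}h(x)\,dx$ for all $k\in\mathbf Z$. Assume that $h>0$ on $[-1/2,1/2]$, that $h$ is three times continuously differentiable on $[-1/2,1/2]$ (one-sidedly at the endpoints), and that its one-sided derivatives at the endpoints agree, $h'(-1/2)=h'(1/2)$ (so that the $1$-periodic extension of $h$ is continuously differentiable). Let $X=(1-B)^{-(H-1/2)}Y$ be the fractionally differenced process driven by $Y$, where $B$ is the backshift operator; that is, for every $t$, $$X(t)=\sum_{j=0}^\infty \frac{\Gamma(j+H-\tfrac12)}{\Gamma(H-\tfrac12)\,\Gamma(j+1)}\,Y(t-j)\qquad\text{in mean square.}$$ Let $$\gamma_H^*(n)=\frac{\mathcal V}{2}\left(|n+1|^{2H}+|n-1|^{2H}-2|n|^{2H}\right)$$ be the autocovariance function of the fractional Gaussian noise with Hurst parameter $H$ and variance $\mathcal V>0$, where $\mathcal V$ is chosen so that $c_f=c_f^*$, with $$c_f=(2\pi)^{1-2H}h(0),\qquad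 c_f^*=\mathcal V\,(2\pi)^{2-2H}\,\pi^{-1}H\,\Gamma(2H)\sin(H\pi)$$ (these are the constants in $f_H(x)\sim c_f|x|^{-(2H-1)}$ and $f_H^*(x)\sim c_f^*|x|^{-(2H-1)}$ as $x\to0$, for the spectral densities $f_H$ of $X$ and $f_H^*$ of the fractional Gaussian noise). Then $X$ is second-order stationary, and its autocovariance function $\gamma_H(n)=\operatorname{Cov}(X(0),X(n))$ satisfies $$\gamma_H(n)=\gamma_H^*(n)+O(n^{2H-4})\qquad(n\to\infty).$$ -/

import Mathlib

open MeasureTheory ProbabilityTheory Filter Topology Asymptotics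

noncomputable section

namespace FracDiff

/-- A real process indexed by the integers is second-order stationary: square integrable, with
constant mean, and with covariances that depend on the lag only. -/
structure SecondOrderStationary {Ω : Type*} [MeasurableSpace Ω] (X : ℤ → Ω → ℝ)
    (P : Measure Ω) : Prop where
  memLp : ∀ t, MemLp (X t) 2 P
  mean_eq : ∀ s t, ∫ ω, X s ω ∂P = ∫ ω, X t ω ∂P
  cov_eq : ∀ s t k, covariance (X s) (X (s + k)) P = covariance (X t) (X (t + k)) P

/-- The autocovariance function `γ(k) = E[(X(0) - μ)(X(k) - μ)]` of a second-order stationary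
process. -/
def acvf {Ω : Type*} [MeasurableSpace Ω] (X : ℤ → Ω → ℝ) (P : Measure Ω) (k : ℤ) : ℝ :=
  covariance (X 0) (X k) P

/-- `f` is a spectral density, in normalised frequency `x ∈ [-1/2, 1/2]`, of the autocovariance
function `γ`: it is nonnegative and integrable, and
`γ(k) = ∫_{-1/2}^{1/2} exp(2πikx) f(x) dx` for all integers `k`. -/
structure HasSpectralDensity (γ : ℤ → ℝ) (f : ℝ → ℝ) : Prop where
  nonneg : ∀ x ∈ Set.Icc (-1 / 2 : ℝ) (1 / 2), 0 ≤ f x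
  integrable : IntervalIntegrable f volume (-1 / 2) (1 / 2)
  eq_integral : ∀ k : ℤ, (γ k : ℂ) =
    ∫ x in (-1 / 2 : ℝ)..(1 / 2), Complex.exp (2 * Real.pi * Complex.I * k * x) * (f x : ℂ)

/-- The coefficient `Γ(j - d) / (Γ(-d) Γ(j + 1))` of `B ^ j` in `(1 - B) ^ d`
(for `d` not a nonnegative integer). -/
def diffCoeff (d : ℝ) (j : ℕ) : ℝ :=
  Real.Gamma (j - d) / (Real.Gamma (-d) * Real.Gamma (j + 1))

/-- `X = (1 - B) ^ d Y`, where `B` is the backshift operator: for every `t`, the random variable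
`X t` is the mean-square limit of the partial sums of `∑ j, diffCoeff d j * Y (t - j)`. -/
def IsFractionalDifference {Ω : Type*} [MeasurableSpace Ω] (d : ℝ) (Y X : ℤ → Ω → ℝ)
    (P : Measure Ω) : Prop :=
  ∀ t : ℤ, MemLp (X t) 2 P ∧
    Tendsto (fun N : ℕ =>
      eLpNorm (fun ω => X t ω - ∑ j ∈ Finset.range N, diffCoeff d j * Y (t - j) ω) 2 P)
      atTop (𝓝 0)

/-- The autocovariance function of fractional Gaussian noise with Hurst parameter `H` and
variance `V`; its variance time function is `V * m ^ (2 * H)`. -/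
def fgnACVF (H V : ℝ) (n : ℤ) : ℝ :=
  V / 2 * (|(n : ℝ) + 1| ^ (2 * H) + |(n : ℝ) - 1| ^ (2 * H) - 2 * |(n : ℝ)| ^ (2 * H))

/-- The constant in `f_H(x) ~ c_f |x| ^ (-(2H - 1))` as `x → 0`, where
`f_H(x) = h(x) |2 sin πx| ^ (-(2H - 1))` is the spectral density of the fractionally differenced
process driven by a process with spectral density `h`. -/
def cf (H : ℝ) (h : ℝ → ℝ) : ℝ :=
  (2 * Real.pi) ^ (1 - 2 * H) * h 0

/-- The constant in `f*_H(x) ~ c_f* |x| ^ (-(2H - 1))` as `x → 0`, where `f*_H` is the spectral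
density of fractional Gaussian noise with Hurst parameter `H` and variance `V`. -/
def cfStar (H V : ℝ) : ℝ :=
  V * (2 * Real.pi) ^ (2 - 2 * H) *
    (Real.pi⁻¹ * H * Real.Gamma (2 * H) * Real.sin (H * Real.pi))

end FracDiff

end

/-! Write `d = H - 1/2`, so that `2d - 1 = 2H - 2` and `2d - 3 = 2H - 4`. The covariances of `X` are
the convolution of `γ`, the autocovariance of `Y`, with `G`, that of fractionally differenced white
noise (`acvf_eq_tsum`). Both `γ_H` and `γ_H^*` are compared with the same term `V H (2H - 1) n^(2H -
2)`.

For `G`, a beta integral and the negative binomial series give a Laplace transform with the positive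
kernel `(2 sinh (u/2))^(-2d)`. This kernel lies between `u^(-2d) - u^(2-2d)` and `u^(-2d)`, so `G(n)
= A n^(2d-1) + O(n^(2d-3))`. Positivity also makes `G` decreasing and bounds its second differences
of step `m` by `m²` times a constant multiple of `(n - m)^(2d-3)`.

For `γ`, three integrations by parts give `|k|³ |γ(k)| ≤ |s_k|` with `s_k` square summable. Hence
`γ(k) = O(|k|⁻³)` and `∑ k² |γ(k)| < ∞` (`decay`), while `∑ γ(k) = h(0)` by Fourier inversion
(`hasSum`).

Since `γ` is even, the first-order terms of the convolution cancel, and the second moment of `γ`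
controls the rest: the convolution is `h(0) A n^(2d-1) + O(n^(2d-3))` (`exists_convolution_bound`).
The condition `c_f = c_f^*` says `h(0) A = V H (2H - 1)` by the reflection formula
(`mul_arfimaConst_eq`), and a Taylor expansion gives the same leading term for the fractional
Gaussian noise (`fgnACVF_isBigO`). -/

/-! ### Fourier coefficients of a `C³` function on an interval. -/

/-- Integration by parts on `[-1/2, 1/2]` against a sine that vanishes at both endpoints. -/
lemma integral_cos_mul_eq_sin {g g' : ℝ → ℝ}
    (hg : ∀ x ∈ Set.Icc (-1 / 2 : ℝ) (1 / 2),
      HasDerivWithinAt g (g' x) (Set.Icc (-1 / 2 : ℝ) (1 / 2)) x)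
    (hg' : ContinuousOn g' (Set.Icc (-1 / 2 : ℝ) (1 / 2))) (k : ℤ) :
    (2 * Real.pi * k) * ∫ x in (-1 / 2 : ℝ)..(1 / 2), Real.cos (2 * Real.pi * k * x) * g x =
      -∫ x in (-1 / 2 : ℝ)..(1 / 2), Real.sin (2 * Real.pi * k * x) * g' x := by
  have hu : Set.uIcc (-1 / 2 : ℝ) (1 / 2) = Set.Icc (-1 / 2 : ℝ) (1 / 2) :=
    Set.uIcc_of_le (by norm_num)
  have key := intervalIntegral.integral_mul_deriv_eq_deriv_mul_of_hasDerivWithinAt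
    (a := (-1 / 2 : ℝ)) (b := 1 / 2) (u := g) (u' := g')
    (v := fun x => Real.sin (2 * Real.pi * k * x))
    (v' := fun x => Real.cos (2 * Real.pi * k * x) * (2 * Real.pi * k))
    (by rwa [hu]) (fun x _ => by
      have := ((hasDerivAt_id x).const_mul (2 * Real.pi * k)).sin
      simpa using this.hasDerivWithinAt)
    (by rw [← hu] at hg'; exact hg'.intervalIntegrable)
    ((by fun_prop : Continuous _).intervalIntegrable _ _)
  have e1 : Real.sin (2 * Real.pi * k * (1 / 2)) = 0 := by
    rw [show 2 * Real.pi * k * (1 / 2) = k * Real.pi by ring]; exact Real.sin_int_mul_pi k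
  have e2 : Real.sin (2 * Real.pi * k * (-1 / 2)) = 0 := by
    rw [show 2 * Real.pi * k * (-1 / 2) = -(k * Real.pi) by ring, Real.sin_neg,
      Real.sin_int_mul_pi, neg_zero]
  simp only [e1, e2, mul_zero, sub_zero, zero_sub] at key
  rw [← intervalIntegral.integral_const_mul]
  simp_rw [mul_comm (Real.sin _)]
  rw [← key]
  congr 1 with x
  ring

/-- Integration by parts on `[-1/2, 1/2]` against a cosine, for a function with equal values at the
endpoints. -/
lemma integral_sin_mul_eq_cos {g g' : ℝ → ℝ}
    (hg : ∀ x ∈ Set.Icc (-1 / 2 : ℝ) (1 / 2),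
      HasDerivWithinAt g (g' x) (Set.Icc (-1 / 2 : ℝ) (1 / 2)) x)
    (hg' : ContinuousOn g' (Set.Icc (-1 / 2 : ℝ) (1 / 2))) (hper : g (-1 / 2) = g (1 / 2)) (k : ℤ) :
    (2 * Real.pi * k) * ∫ x in (-1 / 2 : ℝ)..(1 / 2), Real.sin (2 * Real.pi * k * x) * g x =
      ∫ x in (-1 / 2 : ℝ)..(1 / 2), Real.cos (2 * Real.pi * k * x) * g' x := by
  have hu : Set.uIcc (-1 / 2 : ℝ) (1 / 2) = Set.Icc (-1 / 2 : ℝ) (1 / 2) :=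
    Set.uIcc_of_le (by norm_num)
  have key := intervalIntegral.integral_mul_deriv_eq_deriv_mul_of_hasDerivWithinAt
    (a := (-1 / 2 : ℝ)) (b := 1 / 2) (u := g) (u' := g')
    (v := fun x => -Real.cos (2 * Real.pi * k * x))
    (v' := fun x => Real.sin (2 * Real.pi * k * x) * (2 * Real.pi * k))
    (by rwa [hu]) (fun x _ => by
      have := ((hasDerivAt_id x).const_mul (2 * Real.pi * k)).cos.fun_neg
      simpa using this.hasDerivWithinAt)
    (by rw [← hu] at hg'; exact hg'.intervalIntegrable)
    ((by fun_prop : Continuous _).intervalIntegrable _ _)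
  have e1 : Real.cos (2 * Real.pi * k * (-1 / 2)) = Real.cos (2 * Real.pi * k * (1 / 2)) := by
    rw [← Real.cos_neg]; congr 1; ring
  simp only [e1, hper, sub_self, zero_sub, mul_neg, intervalIntegral.integral_neg, neg_neg] at key
  rw [← intervalIntegral.integral_const_mul]
  simp_rw [mul_comm (Real.cos _)]
  rw [← key]
  congr 1 with x
  ring

/-- The cosine coefficients of a `C³` function on `[-1/2, 1/2]` whose derivatives match at the
endpoints are given by the sine coefficients of a continuous function, divided by the cube of the
frequency. -/
lemma exists_cube_mul_cos_coeff {h : ℝ → ℝ}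
    (h_smooth : ContDiffOn ℝ 3 h (Set.Icc (-1 / 2 : ℝ) (1 / 2)))
    (h_match : derivWithin h (Set.Icc (-1 / 2 : ℝ) (1 / 2)) (-1 / 2) =
      derivWithin h (Set.Icc (-1 / 2 : ℝ) (1 / 2)) (1 / 2)) :
    ∃ g : ℝ → ℝ, ContinuousOn g (Set.Icc (-1 / 2 : ℝ) (1 / 2)) ∧ ∀ k : ℤ,
      (2 * Real.pi * k) ^ 3 *
        ∫ x in (-1 / 2 : ℝ)..(1 / 2), Real.cos (2 * Real.pi * k * x) * h x =
      ∫ x in (-1 / 2 : ℝ)..(1 / 2), Real.sin (2 * Real.pi * k * x) * g x := by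
  set I := Set.Icc (-1 / 2 : ℝ) (1 / 2) with hI
  have hU : UniqueDiffOn ℝ I := uniqueDiffOn_Icc (by norm_num)
  have c1 : ContDiffOn ℝ 2 (derivWithin h I) I := h_smooth.derivWithin hU (by norm_num)
  have c2 : ContDiffOn ℝ 1 (derivWithin (derivWithin h I) I) I := c1.derivWithin hU (by norm_num)
  have c3 : ContinuousOn (derivWithin (derivWithin (derivWithin h I) I) I) I :=
    (c2.derivWithin (m := 0) hU (by norm_num)).continuousOn
  have d0 : ∀ x ∈ I, HasDerivWithinAt h (derivWithin h I x) I x := fun x hx =>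
    (h_smooth.differentiableOn (by norm_num) x hx).hasDerivWithinAt
  have d1 : ∀ x ∈ I, HasDerivWithinAt (derivWithin h I) (derivWithin (derivWithin h I) I x) I x :=
    fun x hx => (c1.differentiableOn (by norm_num) x hx).hasDerivWithinAt
  have d2 : ∀ x ∈ I, HasDerivWithinAt (derivWithin (derivWithin h I) I)
      (derivWithin (derivWithin (derivWithin h I) I) I x) I x :=
    fun x hx => (c2.differentiableOn (by norm_num) x hx).hasDerivWithinAt
  refine ⟨_, c3, fun k => ?_⟩
  have i0 := integral_cos_mul_eq_sin d0 c1.continuousOn k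
  -- The only integration whose boundary terms do not vanish through the sine; they cancel because
  -- `h'` agrees at the endpoints.
  have i1 := integral_sin_mul_eq_cos d1 c2.continuousOn h_match k
  have i2 := integral_cos_mul_eq_sin d2 c3 k
  rw [pow_succ, mul_assoc, i0, pow_two]
  linear_combination -(2 * Real.pi * k) * i1 - i2

lemma fourierCoeffOn_eq_integral_exp (g : ℝ → ℂ) (hab : (-1 / 2 : ℝ) < 1 / 2) (k : ℤ) :
    fourierCoeffOn hab g k =
      ∫ x in (-1 / 2 : ℝ)..(1 / 2), Complex.exp (-(2 * Real.pi * Complex.I * k * x)) * g x := by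
  rw [fourierCoeffOn_eq_integral]
  norm_num
  congr 1 with x
  rw [← Complex.exp_conj]
  simp [Complex.conj_ofNat]

/-- The sine coefficients of a continuous function are square summable. -/
lemma summable_sq_sin_coeff {g : ℝ → ℝ} (hg : ContinuousOn g (Set.Icc (-1 / 2 : ℝ) (1 / 2))) :
    Summable fun k : ℤ =>
      (∫ x in (-1 / 2 : ℝ)..(1 / 2), Real.sin (2 * Real.pi * k * x) * g x) ^ 2 := by
  have hab : (-1 / 2 : ℝ) < 1 / 2 := by norm_num
  have hgc : ContinuousOn (fun x => (g x : ℂ)) (Set.Icc (-1 / 2 : ℝ) (1 / 2)) :=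
    Complex.continuous_ofReal.comp_continuousOn hg
  have hL : MemLp (fun x => (g x : ℂ)) 2 (volume.restrict (Set.Ioc (-1 / 2 : ℝ) (1 / 2))) := by
    obtain ⟨C, hC⟩ := isCompact_Icc.exists_bound_of_continuousOn hgc
    refine MemLp.of_bound ((hgc.mono Set.Ioc_subset_Icc_self).aestronglyMeasurable
      measurableSet_Ioc) C ?_
    filter_upwards [ae_restrict_mem measurableSet_Ioc] with x hx using
      hC x (Set.Ioc_subset_Icc_self hx)
  refine Summable.of_nonneg_of_le (fun _ => sq_nonneg _) (fun k => ?_)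
    (hasSum_sq_fourierCoeffOn hab hL).summable
  rw [fourierCoeffOn_eq_integral_exp, ← sq_abs]
  gcongr
  -- As `g` is real, the sine integral is, up to sign, the imaginary part of a Fourier coefficient,
  -- and Parseval controls the moduli.
  have him : (∫ x in (-1 / 2 : ℝ)..(1 / 2),
      Complex.exp (-(2 * Real.pi * Complex.I * k * x)) * (g x : ℂ)).im =
      -∫ x in (-1 / 2 : ℝ)..(1 / 2), Real.sin (2 * Real.pi * k * x) * g x := by
    have hint : IntervalIntegrable
        (fun x : ℝ => Complex.exp (-(2 * Real.pi * Complex.I * k * x)) * (g x : ℂ)) volume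
        (-1 / 2) (1 / 2) := by
      apply ContinuousOn.intervalIntegrable
      rw [Set.uIcc_of_le hab.le]
      exact (by fun_prop : Continuous _).continuousOn.mul hgc
    rw [intervalIntegral.integral_of_le hab.le, intervalIntegral.integral_of_le hab.le,
      ← integral_neg]
    rw [intervalIntegrable_iff_integrableOn_Ioc_of_le hab.le] at hint
    have := integral_im (𝕜 := ℂ) hint
    simp only [RCLike.im_to_complex] at this
    rw [← this]
    congr 1 with x
    rw [show -(2 * Real.pi * Complex.I * k * x : ℂ) = ((-(2 * Real.pi * k * x) : ℝ) : ℂ) * Complex.I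
      by push_cast; ring, Complex.exp_mul_I, ← Complex.ofReal_cos, ← Complex.ofReal_sin]
    simp [-Complex.ofReal_neg, -Complex.ofReal_mul, -Complex.ofReal_cos, -Complex.ofReal_sin]
  rw [← abs_neg, ← him]
  exact Complex.abs_im_le_norm _


lemma re_integral_exp_mul {h : ℝ → ℝ} (hc : ContinuousOn h (Set.Icc (-1 / 2 : ℝ) (1 / 2))) (k : ℤ) :
    (∫ x in (-1 / 2 : ℝ)..(1 / 2), Complex.exp (2 * Real.pi * Complex.I * k * x) * (h x : ℂ)).re =
      ∫ x in (-1 / 2 : ℝ)..(1 / 2), Real.cos (2 * Real.pi * k * x) * h x := by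
  have hab : (-1 / 2 : ℝ) ≤ 1 / 2 := by norm_num
  have hint : IntervalIntegrable
      (fun x : ℝ => Complex.exp (2 * Real.pi * Complex.I * k * x) * (h x : ℂ)) volume
      (-1 / 2) (1 / 2) := by
    apply ContinuousOn.intervalIntegrable
    rw [Set.uIcc_of_le hab]
    exact (by fun_prop : Continuous _).continuousOn.mul
      (Complex.continuous_ofReal.comp_continuousOn hc)
  rw [intervalIntegral.integral_of_le hab, intervalIntegral.integral_of_le hab]
  rw [intervalIntegrable_iff_integrableOn_Ioc_of_le hab] at hint
  have := integral_re (𝕜 := ℂ) hint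
  simp only [RCLike.re_to_complex] at this
  rw [← this]
  congr 1 with x
  rw [show (2 * Real.pi * Complex.I * k * x : ℂ) = ((2 * Real.pi * k * x : ℝ) : ℂ) * Complex.I
    by push_cast; ring, Complex.exp_mul_I, ← Complex.ofReal_cos, ← Complex.ofReal_sin]
  simp [-Complex.ofReal_mul, -Complex.ofReal_cos, -Complex.ofReal_sin]

/-! ### Decay and sum of the autocovariances of the driving process. -/

namespace FracDiff.HasSpectralDensity

variable {γ : ℤ → ℝ} {h : ℝ → ℝ}

lemma eq_integral_cos (hγ : HasSpectralDensity γ h)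
    (hc : ContinuousOn h (Set.Icc (-1 / 2 : ℝ) (1 / 2))) (k : ℤ) :
    γ k = ∫ x in (-1 / 2 : ℝ)..(1 / 2), Real.cos (2 * Real.pi * k * x) * h x := by
  rw [← re_integral_exp_mul hc, ← hγ.eq_integral, Complex.ofReal_re]

lemma neg_eq (hγ : HasSpectralDensity γ h)
    (hc : ContinuousOn h (Set.Icc (-1 / 2 : ℝ) (1 / 2))) (k : ℤ) : γ (-k) = γ k := by
  rw [hγ.eq_integral_cos hc, hγ.eq_integral_cos hc]
  congr 1 with x
  rw [← Real.cos_neg]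
  push_cast
  ring_nf

/-- The autocovariance of a process with a `C³` spectral density decays like `|k|⁻³`, and
`k² γ(k)` is summable. -/
lemma decay (hγ : HasSpectralDensity γ h)
    (h_smooth : ContDiffOn ℝ 3 h (Set.Icc (-1 / 2 : ℝ) (1 / 2)))
    (h_match : derivWithin h (Set.Icc (-1 / 2 : ℝ) (1 / 2)) (-1 / 2) =
      derivWithin h (Set.Icc (-1 / 2 : ℝ) (1 / 2)) (1 / 2)) :
    (∃ C, ∀ k : ℤ, |(k : ℝ)| ^ 3 * |γ k| ≤ C) ∧ Summable fun k : ℤ => (k : ℝ) ^ 2 * |γ k| := by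
  obtain ⟨g, hg, hk⟩ := exists_cube_mul_cos_coeff h_smooth h_match
  set s : ℤ → ℝ := fun k => ∫ x in (-1 / 2 : ℝ)..(1 / 2), Real.sin (2 * Real.pi * k * x) * g x
  have hs : Summable fun k => s k ^ 2 := summable_sq_sin_coeff hg
  have hle : ∀ k : ℤ, |(k : ℝ)| ^ 3 * |γ k| ≤ |s k| := by
    intro k
    rw [hγ.eq_integral_cos h_smooth.continuousOn, show s k = _ from (hk k).symm, abs_mul, abs_pow,
      abs_mul]
    gcongr
    apply le_mul_of_one_le_left (abs_nonneg _)
    rw [abs_of_pos (by positivity)]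
    linarith [Real.pi_gt_three]
  constructor
  · refine ⟨1 + ∑' k, s k ^ 2, fun k => (hle k).trans ?_⟩
    have h1 : s k ^ 2 ≤ ∑' k, s k ^ 2 := hs.le_tsum k fun _ _ => sq_nonneg _
    rw [← sq_abs] at h1
    nlinarith [sq_nonneg (|s k| - 1 / 2)]
  · have hz : Summable fun k : ℤ => 1 / (k : ℝ) ^ 2 :=
      Real.summable_one_div_int_pow.mpr one_lt_two
    refine Summable.of_nonneg_of_le (fun k => by positivity) (fun k => ?_) (hz.add hs)
    rcases eq_or_ne k 0 with rfl | hk0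
    · simp [sq_nonneg]
    have hkp : 0 < |(k : ℝ)| := by positivity
    have h2 : (k : ℝ) ^ 2 * |γ k| ≤ |s k| * (1 / |(k : ℝ)|) := by
      rw [mul_one_div, le_div_iff₀ hkp, ← sq_abs (k : ℝ)]
      calc _ = |(k : ℝ)| ^ 3 * |γ k| := by ring
        _ ≤ _ := hle k
    have h3 : 1 / (k : ℝ) ^ 2 = (1 / |(k : ℝ)|) ^ 2 := by rw [div_pow, one_pow, sq_abs]
    rw [h3, ← sq_abs (s k)]
    -- `|s_k| / |k| ≤ s_k² + 1/k²`, and both terms are summable.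
    nlinarith [sq_nonneg (|s k| - 1 / |(k : ℝ)|), sq_nonneg (|s k| + 1 / |(k : ℝ)|)]

lemma summable_abs (hs : Summable fun k : ℤ => (k : ℝ) ^ 2 * |γ k|) :
    Summable fun k => |γ k| := by
  refine Summable.of_norm_bounded_eventually (g := fun k : ℤ => (k : ℝ) ^ 2 * |γ k|) hs ?_
  have : ∀ᶠ k : ℤ in cofinite, k ≠ 0 := (Set.finite_singleton 0).compl_mem_cofinite
  filter_upwards [this] with k hk
  rw [Real.norm_eq_abs, abs_abs]
  apply le_mul_of_one_le_left (abs_nonneg _)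
  have : (1 : ℝ) ≤ |(k : ℝ)| := by exact_mod_cast Int.one_le_abs hk
  rw [← sq_abs]
  exact one_le_pow₀ this

/-- The autocovariances sum up to the spectral density at zero. -/
lemma hasSum (hγ : HasSpectralDensity γ h)
    (hc : ContinuousOn h (Set.Icc (-1 / 2 : ℝ) (1 / 2))) (hs : Summable γ) :
    HasSum γ (h 0) := by
  have hab : (-1 / 2 : ℝ) < 1 / 2 := by norm_num
  have hab' : (-1 / 2 : ℝ) ≤ 1 / 2 := hab.le
  -- The even part of `h` has equal values at the endpoints, hence is continuous on the circle; its
  -- coefficients are still `γ` because `γ` is even, and its value at `0` is `h 0`.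
  set g : ℝ → ℂ := fun x => ((h x : ℂ) + (h (-x) : ℂ)) / 2 with hg
  have hc1 : ContinuousOn (fun x => (h x : ℂ)) (Set.Icc (-1 / 2 : ℝ) (1 / 2)) :=
    Complex.continuous_ofReal.comp_continuousOn hc
  have hc2 : ContinuousOn (fun x => (h (-x) : ℂ)) (Set.Icc (-1 / 2 : ℝ) (1 / 2)) :=
    hc1.comp continuous_neg.continuousOn fun x hx => by
      constructor <;> linarith [hx.1, hx.2]
  have hgc : ContinuousOn g (Set.Icc (-1 / 2 : ℝ) (-1 / 2 + 1)) := by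
    rw [show (-1 / 2 + 1 : ℝ) = 1 / 2 by norm_num]
    exact (hc1.add hc2).div_const 2
  have hper : g (-1 / 2) = g (-1 / 2 + 1) := by
    simp only [hg]
    rw [show (-1 / 2 + 1 : ℝ) = 1 / 2 by norm_num, show (-(-1 / 2) : ℝ) = 1 / 2 by norm_num,
      show (-(1 / 2) : ℝ) = -1 / 2 by norm_num, add_comm]
  let f : C(AddCircle (1 : ℝ), ℂ) :=
    ⟨AddCircle.liftIco 1 (-1 / 2) g, AddCircle.liftIco_continuous hper hgc⟩
  have hcoef : ∀ k, fourierCoeff f k = (γ k : ℂ) := by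
    intro k
    change fourierCoeff (AddCircle.liftIco 1 (-1 / 2) g) k = _
    rw [fourierCoeff_liftIco_eq]
    have e : fourierCoeffOn (lt_add_of_pos_right (-1 / 2 : ℝ) one_pos) g k =
        fourierCoeffOn hab g k := by
      congr 1; norm_num
    have i1 : IntervalIntegrable (fun x : ℝ =>
        Complex.exp (-(2 * Real.pi * Complex.I * k * x)) * (h x : ℂ)) volume (-1 / 2) (1 / 2) := by
      apply ContinuousOn.intervalIntegrable
      rw [Set.uIcc_of_le hab']
      exact (by fun_prop : Continuous _).continuousOn.mul hc1
    have i2 : IntervalIntegrable (fun x : ℝ =>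
        Complex.exp (-(2 * Real.pi * Complex.I * k * x)) * (h (-x) : ℂ)) volume
        (-1 / 2) (1 / 2) := by
      apply ContinuousOn.intervalIntegrable
      rw [Set.uIcc_of_le hab']
      exact (by fun_prop : Continuous _).continuousOn.mul hc2
    have s1 : ∫ x in (-1 / 2 : ℝ)..(1 / 2),
        Complex.exp (-(2 * Real.pi * Complex.I * k * x)) * (h x : ℂ) = γ k := by
      rw [← hγ.neg_eq hc, hγ.eq_integral]
      congr 1 with x
      push_cast
      ring_nf
    have s2 : ∫ x in (-1 / 2 : ℝ)..(1 / 2),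
        Complex.exp (-(2 * Real.pi * Complex.I * k * x)) * (h (-x) : ℂ) = γ k := by
      rw [hγ.eq_integral]
      have := intervalIntegral.integral_comp_neg (a := (-1 / 2 : ℝ)) (b := 1 / 2)
        (fun x : ℝ => Complex.exp (2 * Real.pi * Complex.I * k * x) * (h x : ℂ))
      rw [show (-(-1 / 2) : ℝ) = 1 / 2 by norm_num,
        show (-(1 / 2) : ℝ) = -1 / 2 by norm_num] at this
      rw [← this]
      congr 1 with x
      push_cast
      ring_nf
    rw [e, fourierCoeffOn_eq_integral_exp]
    calc _ = ∫ x in (-1 / 2 : ℝ)..(1 / 2),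
          (Complex.exp (-(2 * Real.pi * Complex.I * k * x)) * (h x : ℂ) +
          Complex.exp (-(2 * Real.pi * Complex.I * k * x)) * (h (-x) : ℂ)) / 2 := by
          congr 1 with x; simp only [hg]; ring
      _ = γ k := by
          rw [intervalIntegral.integral_div, intervalIntegral.integral_add i1 i2, s1, s2]; ring
  have hsum : Summable (fourierCoeff f) := by
    rw [show fourierCoeff f = fun k => (γ k : ℂ) from funext hcoef]
    exact_mod_cast hs
  have key := has_pointwise_sum_fourier_series_of_summable hsum ((0 : ℝ) : AddCircle (1 : ℝ))
  have h0 : f ((0 : ℝ) : AddCircle (1 : ℝ)) = (h 0 : ℂ) := by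
    change AddCircle.liftIco 1 (-1 / 2) g _ = _
    rw [AddCircle.liftIco_coe_apply (by norm_num)]
    simp [hg]
  rw [h0] at key
  simp only [hcoef] at key
  have : HasSum (fun k => (γ k : ℂ)) (h 0 : ℂ) := by
    convert key using 2 with k
    simp
  exact_mod_cast this

end FracDiff.HasSpectralDensity

/-! ### Beta integral and negative binomial series. -/

lemma exp_neg_lt_one {u : ℝ} (hu : 0 < u) : Real.exp (-u) < 1 := by simpa using hu

/-- The beta integral after the substitution `x = exp (-u)`. -/
lemma integral_exp_mul_one_sub_exp_rpow {α β : ℝ} (hα : 0 < α) (hβ : 0 < β) :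
    ∫ u in Set.Ioi (0 : ℝ), Real.exp (-(α * u)) * (1 - Real.exp (-u)) ^ (β - 1) = beta α β := by
  have himg : (fun u : ℝ => Real.exp (-u)) '' Set.Ioi 0 = Set.Ioo 0 1 := by
    ext x
    constructor
    · rintro ⟨u, hu, rfl⟩
      exact ⟨Real.exp_pos _, exp_neg_lt_one hu⟩
    · rintro ⟨h0, h1⟩
      exact ⟨-Real.log x, neg_pos.mpr (Real.log_neg h0 h1), by simp [Real.exp_log h0]⟩
  have hsub := integral_image_eq_integral_abs_deriv_smul (s := Set.Ioi (0 : ℝ))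
    (f := fun u => Real.exp (-u)) (f' := fun u => -Real.exp (-u)) measurableSet_Ioi
    (fun u _ => by simpa using (hasDerivAt_neg u).exp.hasDerivWithinAt)
    (fun x _ y _ hxy => by simpa using hxy) (fun x : ℝ => x ^ (α - 1) * (1 - x) ^ (β - 1))
  rw [himg] at hsub
  rw [beta_eq_betaIntegralReal α β hα hβ, Complex.betaIntegral,
    intervalIntegral.integral_of_le zero_le_one, integral_Ioc_eq_integral_Ioo]
  have hre : ∫ x in Set.Ioo (0 : ℝ) 1, (x : ℂ) ^ ((α : ℂ) - 1) * (1 - (x : ℂ)) ^ ((β : ℂ) - 1) =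
      ((∫ x in Set.Ioo (0 : ℝ) 1, x ^ (α - 1) * (1 - x) ^ (β - 1) : ℝ) : ℂ) := by
    rw [← integral_complex_ofReal]
    refine setIntegral_congr_fun measurableSet_Ioo fun x hx => ?_
    have h1 : 0 ≤ 1 - x := by linarith [hx.2]
    simp only [Complex.ofReal_mul, Complex.ofReal_cpow hx.1.le, Complex.ofReal_cpow h1]
    push_cast
    rfl
  rw [hre, Complex.ofReal_re, hsub]
  refine setIntegral_congr_fun measurableSet_Ioi fun u _ => ?_
  simp only [abs_neg, Real.abs_exp, smul_eq_mul]
  rw [← mul_assoc, ← Real.exp_mul, ← Real.exp_add]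
  ring_nf

/-- The negative binomial series, with coefficients written through the Gamma function. -/
lemma hasSum_Gamma_add_div_mul_pow {d x : ℝ} (hd : 0 < d) (hx0 : 0 ≤ x) (hx1 : x < 1) :
    HasSum (fun j : ℕ => Real.Gamma (j + d) / Real.Gamma (j + 1) * x ^ j)
      (Real.Gamma d * (1 - x) ^ (-d)) := by
  have hx : 0 < 1 - x := by linarith
  -- Write `Γ(j + d)` as its Euler integral and sum the exponential series of `x t` under the
  -- integral sign.
  set F : ℕ → ℝ → ℝ := fun j t => Real.exp (-t) * t ^ ((j : ℝ) + d - 1) * (x ^ j / j.factorial)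
  set f : ℝ → ℝ := fun t => t ^ (d - 1) * Real.exp (-((1 - x) * t))
  have hF : ∀ j, ∫ t in Set.Ioi (0 : ℝ), F j t =
      Real.Gamma (j + d) / Real.Gamma (j + 1) * x ^ j := by
    intro j
    rw [integral_mul_const, ← Real.Gamma_eq_integral (by positivity), Real.Gamma_nat_eq_factorial]
    ring
  have hf : ∫ t in Set.Ioi (0 : ℝ), f t = Real.Gamma d * (1 - x) ^ (-d) := by
    rw [Real.integral_rpow_mul_exp_neg_mul_Ioi hd hx, one_div, Real.inv_rpow hx.le,
      Real.rpow_neg hx.le, mul_comm]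
  have hsum : ∀ t ∈ Set.Ioi (0 : ℝ), HasSum (fun j => F j t) (f t) := by
    intro t ht
    have ht0 : (0 : ℝ) < t := ht
    have h1 : HasSum (fun j : ℕ => (x * t) ^ j / j.factorial) (Real.exp (x * t)) := by
      rw [Real.exp_eq_exp_ℝ]; exact NormedSpace.expSeries_div_hasSum_exp _
    convert! h1.mul_left (t ^ (d - 1) * Real.exp (-t)) using 1
    · ext j
      simp only [F]
      rw [show (j : ℝ) + d - 1 = j + (d - 1) by ring, Real.rpow_add ht0, Real.rpow_natCast, mul_pow]
      ring
    · simp only [f]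
      rw [mul_assoc, ← Real.exp_add]
      ring_nf
  -- A function that is not integrable has integral `0` by convention, so the nonzero value of the
  -- integral proves integrability.
  have hint : IntegrableOn f (Set.Ioi 0) := by
    refine .of_integral_ne_zero ?_
    rw [hf]
    exact (mul_pos (Real.Gamma_pos_of_pos hd) (Real.rpow_pos_of_pos hx _)).ne'
  have hmem := ae_restrict_mem (μ := volume) (measurableSet_Ioi (a := (0 : ℝ)))
  -- The terms are nonnegative, so `F` serves as its own dominating family.
  have key := hasSum_integral_of_dominated_convergence (μ := volume.restrict (Set.Ioi (0 : ℝ)))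
    (F := F) (f := f) F
    (fun j => by
      refine ContinuousOn.aestronglyMeasurable (fun t ht => ?_) measurableSet_Ioi
      have ht0 : t ≠ 0 := (ne_of_gt ht)
      exact ((Real.continuous_exp.comp continuous_neg).continuousAt.mul
        (Real.continuousAt_rpow_const t _ (Or.inl ht0)) |>.mul continuousAt_const).continuousWithinAt)
    (fun j => by
      filter_upwards [hmem] with t ht
      have ht0 : (0 : ℝ) < t := ht
      rw [Real.norm_of_nonneg (by positivity)])
    (by filter_upwards [hmem] with t ht using (hsum t ht).summable)
    (hint.congr (by filter_upwards [hmem] with t ht using (hsum t ht).tsum_eq.symm))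
    (by filter_upwards [hmem] with t ht using hsum t ht)
  simpa only [hF, hf] using key

/-! ### Autocovariances of fractionally differenced white noise as a Laplace transform. -/

namespace FracDiff

/-- The Laplace density of the autocovariances of the fractionally differenced white noise. -/
noncomputable def arfimaKernel (d u : ℝ) : ℝ := (2 * Real.sinh (u / 2)) ^ (-(2 * d))

/-- The autocovariance function of the fractionally differenced white noise `(1 - B) ^ (-d) ε`,
in the form of a Laplace transform. -/
noncomputable def arfimaACVF (d x : ℝ) : ℝ :=
  (Real.Gamma d * Real.Gamma (1 - d))⁻¹ *
    ∫ u in Set.Ioi (0 : ℝ), Real.exp (-(x * u)) * arfimaKernel d u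

lemma diffCoeff_neg (d : ℝ) (j : ℕ) :
    diffCoeff (-d) j = Real.Gamma (j + d) / (Real.Gamma d * Real.Gamma (j + 1)) := by
  rw [diffCoeff, neg_neg, sub_neg_eq_add]

lemma diffCoeff_neg_pos {d : ℝ} (hd : 0 < d) (j : ℕ) : 0 < diffCoeff (-d) j := by
  rw [diffCoeff_neg]
  have h1 := Real.Gamma_pos_of_pos hd
  have h2 := Real.Gamma_pos_of_pos (show 0 < (j : ℝ) + d by positivity)
  have h3 := Real.Gamma_pos_of_pos (show 0 < (j : ℝ) + 1 by positivity)
  positivity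

lemma diffCoeff_neg_eq_integral {d : ℝ} (hd : 0 < d) (hd1 : d < 1) (j : ℕ) :
    diffCoeff (-d) j = (Real.Gamma d * Real.Gamma (1 - d))⁻¹ *
      ∫ u in Set.Ioi (0 : ℝ), Real.exp (-((j + d) * u)) * (1 - Real.exp (-u)) ^ (-d) := by
  have h := integral_exp_mul_one_sub_exp_rpow (α := j + d) (β := 1 - d) (by positivity)
    (by linarith)
  rw [show 1 - d - 1 = -d by ring] at h
  rw [h, diffCoeff_neg, beta, show (j : ℝ) + d + (1 - d) = j + 1 by ring]
  have h1 := (Real.Gamma_pos_of_pos hd).ne'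
  have h2 := (Real.Gamma_pos_of_pos (show 0 < 1 - d by linarith)).ne'
  field_simp

lemma hasSum_diffCoeff_neg_mul_exp {d u : ℝ} (hd : 0 < d) (hu : 0 < u) :
    HasSum (fun j : ℕ => diffCoeff (-d) j * Real.exp (-(j * u)))
      ((1 - Real.exp (-u)) ^ (-d)) := by
  have h := (hasSum_Gamma_add_div_mul_pow hd (Real.exp_pos (-u)).le
    (exp_neg_lt_one hu)).mul_left (Real.Gamma d)⁻¹
  have h1 := (Real.Gamma_pos_of_pos hd).ne'
  rw [← mul_assoc, inv_mul_cancel₀ h1, one_mul] at h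
  convert! h using 2 with j
  rw [diffCoeff_neg, ← Real.exp_nat_mul]
  have h3 := (Real.Gamma_pos_of_pos (show 0 < (j : ℝ) + 1 by positivity)).ne'
  field_simp

lemma two_mul_sinh_half_pos {u : ℝ} (hu : 0 < u) : 0 < 2 * Real.sinh (u / 2) := by
  have := Real.sinh_pos_iff.mpr (half_pos hu)
  positivity

lemma arfimaKernel_pos {d u : ℝ} (hu : 0 < u) : 0 < arfimaKernel d u :=
  Real.rpow_pos_of_pos (two_mul_sinh_half_pos hu) _

/-- This is the form in which the kernel arises: one power of `1 - exp (-u)` comes from the beta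
integral for one coefficient, the other from the generating series of the other coefficient. -/
lemma arfimaKernel_eq {d u : ℝ} (hu : 0 < u) :
    arfimaKernel d u =
      Real.exp (-(d * u)) * (1 - Real.exp (-u)) ^ (-d) * (1 - Real.exp (-u)) ^ (-d) := by
  have h1 : 0 < 1 - Real.exp (-u) := by
    linarith [exp_neg_lt_one hu]
  have h2 : 2 * Real.sinh (u / 2) = Real.exp (u / 2) * (1 - Real.exp (-u)) := by
    rw [Real.sinh_eq, mul_sub, ← Real.exp_add]
    ring_nf
  rw [arfimaKernel, h2, Real.mul_rpow (Real.exp_pos _).le h1.le, ← Real.exp_mul, mul_assoc,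
    ← Real.rpow_add h1]
  ring_nf

lemma continuousOn_arfimaKernel (d : ℝ) : ContinuousOn (arfimaKernel d) (Set.Ioi 0) := by
  intro u hu
  have : ContinuousAt (fun u : ℝ => 2 * Real.sinh (u / 2)) u := by fun_prop
  exact (this.rpow_const (Or.inl (two_mul_sinh_half_pos hu).ne')).continuousWithinAt

lemma arfimaKernel_le {d u : ℝ} (hd : 0 < d) (hu : 0 < u) : arfimaKernel d u ≤ u ^ (-(2 * d)) := by
  apply Real.rpow_le_rpow_of_nonpos hu _ (by linarith)
  linarith [Real.self_le_sinh_iff.mpr (half_pos hu).le]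

/-- `x cosh x - sinh x` has derivative `x sinh x ≥ 0`, so `sinh x ≤ x cosh x`, and `cosh x ≤ exp
(x²/2)`. -/
lemma sinh_le_mul_exp_sq {x : ℝ} (hx : 0 ≤ x) : Real.sinh x ≤ x * Real.exp (x ^ 2 / 2) := by
  have hmono : MonotoneOn (fun x => x * Real.cosh x - Real.sinh x) (Set.Ici 0) := by
    refine monotoneOn_of_deriv_nonneg (convex_Ici 0) (by fun_prop) (by fun_prop) fun y hy => ?_
    rw [interior_Ici] at hy
    have : HasDerivAt (fun x => x * Real.cosh x - Real.sinh x) (y * Real.sinh y) y := by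
      have h := ((hasDerivAt_id y).fun_mul (Real.hasDerivAt_cosh y)).fun_sub (Real.hasDerivAt_sinh y)
      convert! h using 1
      simp
    rw [this.deriv]
    exact mul_nonneg hy.le (Real.sinh_nonneg_iff.mpr hy.le)
  have h := hmono (Set.self_mem_Ici) (show x ∈ Set.Ici 0 from hx) hx
  simp only [Real.sinh_zero, zero_mul, sub_zero] at h
  nlinarith [mul_le_mul_of_nonneg_left (Real.cosh_le_exp_half_sq x) hx]

/-- For `d > 0`, the bound on `sinh` costs a factor `exp (-d u²/4) ≥ 1 - u²`. The relative error is
of order `u²`, with no linear term, which is why the covariances gain two powers of `x`. -/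
lemma le_arfimaKernel {d u : ℝ} (hd1 : d < 1 / 2) (hu : 0 < u) :
    u ^ (-(2 * d)) - u ^ (2 - 2 * d) ≤ arfimaKernel d u := by
  have hs := two_mul_sinh_half_pos hu
  have h1 : 2 * Real.sinh (u / 2) ≤ u * Real.exp (u ^ 2 / 8) := by
    have := sinh_le_mul_exp_sq (half_pos hu).le
    rw [show (u / 2) ^ 2 / 2 = u ^ 2 / 8 by ring] at this
    linarith
  by_cases hd : d ≤ 0
  · have : u ^ (-(2 * d)) ≤ arfimaKernel d u := by
      apply Real.rpow_le_rpow hu.le _ (by linarith)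
      linarith [Real.self_le_sinh_iff.mpr (half_pos hu).le]
    linarith [Real.rpow_pos_of_pos hu (2 - 2 * d)]
  push Not at hd
  have h2 : (u * Real.exp (u ^ 2 / 8)) ^ (-(2 * d)) ≤ arfimaKernel d u :=
    Real.rpow_le_rpow_of_nonpos hs h1 (by linarith)
  rw [Real.mul_rpow hu.le (Real.exp_pos _).le, ← Real.exp_mul] at h2
  have h3 : 1 - u ^ 2 ≤ Real.exp (u ^ 2 / 8 * -(2 * d)) := by
    have := Real.add_one_le_exp (u ^ 2 / 8 * -(2 * d))
    nlinarith [sq_nonneg u]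
  have h4 : u ^ (2 - 2 * d) = u ^ (-(2 * d)) * u ^ 2 := by
    rw [show 2 - 2 * d = -(2 * d) + (2 : ℕ) by push_cast; ring, Real.rpow_add hu,
      Real.rpow_natCast]
  rw [h4]
  nlinarith [mul_le_mul_of_nonneg_left h3 (Real.rpow_pos_of_pos hu (-(2 * d))).le]

lemma integrableOn_exp_mul_rpow {s x : ℝ} (hs : -1 < s) (hx : 0 < x) :
    IntegrableOn (fun u => Real.exp (-(x * u)) * u ^ s) (Set.Ioi 0) := by
  have := integrableOn_rpow_mul_exp_neg_mul_rpow hs zero_lt_one hx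
  simpa [mul_comm] using this

lemma integral_exp_mul_rpow {s x : ℝ} (hs : -1 < s) (hx : 0 < x) :
    ∫ u in Set.Ioi (0 : ℝ), Real.exp (-(x * u)) * u ^ s = Real.Gamma (s + 1) * x ^ (-(s + 1)) := by
  have := Real.integral_rpow_mul_exp_neg_mul_Ioi (a := s + 1) (by linarith) hx
  rw [add_sub_cancel_right, one_div, Real.inv_rpow hx.le, ← Real.rpow_neg hx.le] at this
  rw [mul_comm, ← this]
  simp_rw [mul_comm]

/-- At the origin the kernel is of order `u^(-2d)` with `2d < 1`; at infinity it decays by itself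
like `exp (-d u)`, so `x = 0` is allowed. -/
lemma integrableOn_exp_mul_arfimaKernel {d x : ℝ} (hd : 0 < d) (hd1 : d < 1 / 2) (hx : 0 ≤ x) :
    IntegrableOn (fun u => Real.exp (-(x * u)) * arfimaKernel d u) (Set.Ioi 0) := by
  have hb := (integrableOn_exp_mul_rpow (s := -(2 * d)) (x := d) (by linarith) hd).add
    (integrableOn_exp_mul_rpow (s := 1 - 2 * d) (x := d) (by linarith) hd)
  refine Integrable.mono' hb ?_ ?_
  · exact ContinuousOn.aestronglyMeasurable
      ((by fun_prop : Continuous fun u => Real.exp (-(x * u))).continuousOn.mul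
        (continuousOn_arfimaKernel d)) measurableSet_Ioi
  filter_upwards [ae_restrict_mem measurableSet_Ioi] with u hu
  have hu0 : (0 : ℝ) < u := hu
  have hK := arfimaKernel_pos (d := d) hu0
  rw [Real.norm_of_nonneg (by positivity)]
  have h1 : Real.exp (-(x * u)) ≤ 1 := Real.exp_le_one_iff.mpr (by nlinarith)
  have h2 : u / (1 + u) ≤ 1 - Real.exp (-u) := by
    have h3 : Real.exp (-u) ≤ 1 / (1 + u) := by
      rw [Real.exp_neg, ← one_div]
      exact one_div_le_one_div_of_le (by positivity) (by linarith [Real.add_one_le_exp u])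
    have h4 : u / (1 + u) = 1 - 1 / (1 + u) := by field_simp; ring
    linarith
  have h5 : (1 - Real.exp (-u)) ^ (-(2 * d)) ≤ u ^ (-(2 * d)) * (1 + u) := by
    calc _ ≤ (u / (1 + u)) ^ (-(2 * d)) :=
          Real.rpow_le_rpow_of_nonpos (by positivity) h2 (by linarith)
      _ = u ^ (-(2 * d)) * (1 + u) ^ (2 * d) := by
          rw [Real.div_rpow hu0.le (by positivity), Real.rpow_neg (x := 1 + u) (by positivity),
            div_inv_eq_mul]
      _ ≤ u ^ (-(2 * d)) * (1 + u) ^ (1 : ℝ) := by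
          gcongr <;> linarith
      _ = _ := by rw [Real.rpow_one]
  have hp : 0 < 1 - Real.exp (-u) := by linarith [exp_neg_lt_one hu0]
  rw [arfimaKernel_eq hu0, mul_assoc (Real.exp _) _ ((1 - Real.exp (-u)) ^ (-d)),
    ← Real.rpow_add hp, show -d + -d = -(2 * d) by ring]
  simp only [Pi.add_apply]
  calc _ ≤ 1 * (Real.exp (-(d * u)) * (u ^ (-(2 * d)) * (1 + u))) := by gcongr
    _ = _ := by
      rw [show 1 - 2 * d = -(2 * d) + 1 by ring, Real.rpow_add hu0, Real.rpow_one]; ring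

/-- The autocovariances of `(1 - B) ^ (-d) ε` as the sums of lagged products of the coefficients. -/
lemma hasSum_diffCoeff_mul_diffCoeff {d : ℝ} (hd : 0 < d) (hd1 : d < 1 / 2) (k : ℕ) :
    HasSum (fun i : ℕ => diffCoeff (-d) i * diffCoeff (-d) (i + k)) (arfimaACVF d k) := by
  -- Only the coefficient of index `i + k` is replaced by its integral; the one of index `i` is
  -- kept, to be summed as a generating series.
  set F : ℕ → ℝ → ℝ := fun i u => diffCoeff (-d) i *
    (Real.exp (-(((i + k : ℕ) + d) * u)) * (1 - Real.exp (-u)) ^ (-d))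
  set f : ℝ → ℝ := fun u => Real.exp (-(k * u)) * arfimaKernel d u
  have hsum : ∀ u ∈ Set.Ioi (0 : ℝ), HasSum (fun i => F i u) (f u) := by
    intro u (hu : 0 < u)
    convert! (hasSum_diffCoeff_neg_mul_exp hd hu).mul_left
      (Real.exp (-(k * u)) * (Real.exp (-(d * u)) * (1 - Real.exp (-u)) ^ (-d))) using 1
    · ext i
      simp only [F]
      rw [show -(((i + k : ℕ) + d) * u) = -(k * u) + -(d * u) + -(i * u) by push_cast; ring,
        Real.exp_add, Real.exp_add]
      ring
    · simp only [f]
      rw [arfimaKernel_eq hu]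
      ring
  have hint : IntegrableOn f (Set.Ioi 0) :=
    integrableOn_exp_mul_arfimaKernel hd hd1 (Nat.cast_nonneg k)
  have hmem := ae_restrict_mem (μ := volume) (measurableSet_Ioi (a := (0 : ℝ)))
  have hpos : ∀ u ∈ Set.Ioi (0 : ℝ), 0 < 1 - Real.exp (-u) := fun u hu => by
    linarith [exp_neg_lt_one hu]
  have key := hasSum_integral_of_dominated_convergence (μ := volume.restrict (Set.Ioi (0 : ℝ)))
    (F := F) (f := f) F
    (fun i => by
      refine ContinuousOn.aestronglyMeasurable (fun u hu => ?_) measurableSet_Ioi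
      have h1 : ContinuousAt (fun u => (1 - Real.exp (-u)) ^ (-d)) u :=
        ContinuousAt.rpow_const (by fun_prop) (Or.inl (hpos u hu).ne')
      have h2 : ContinuousAt (fun u => Real.exp (-(((i + k : ℕ) + d) * u))) u := by fun_prop
      exact (continuousAt_const.mul (h2.mul h1)).continuousWithinAt)
    (fun i => by
      filter_upwards [hmem] with u hu
      have h1 := hpos u hu
      have h2 := diffCoeff_neg_pos hd i
      rw [Real.norm_of_nonneg (by positivity)])
    (by filter_upwards [hmem] with t ht using (hsum t ht).summable)
    (hint.congr (by filter_upwards [hmem] with t ht using (hsum t ht).tsum_eq.symm))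
    (by filter_upwards [hmem] with t ht using hsum t ht)
  convert! key.mul_left (Real.Gamma d * Real.Gamma (1 - d))⁻¹ using 1
  ext i
  simp only [F]
  rw [integral_const_mul, diffCoeff_neg_eq_integral hd (by linarith) (i + k)]
  ring

lemma arfima_const_pos {d : ℝ} (hd : 0 < d) (hd1 : d < 1) :
    0 < (Real.Gamma d * Real.Gamma (1 - d))⁻¹ :=
  inv_pos.mpr (mul_pos (Real.Gamma_pos_of_pos hd) (Real.Gamma_pos_of_pos (by linarith)))

lemma arfimaACVF_nonneg {d : ℝ} (hd : 0 < d) (hd1 : d < 1) (x : ℝ) : 0 ≤ arfimaACVF d x :=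
  mul_nonneg (arfima_const_pos hd hd1).le <| setIntegral_nonneg measurableSet_Ioi fun _ hu =>
    mul_nonneg (Real.exp_pos _).le (arfimaKernel_pos hu).le

lemma arfimaACVF_anti {d x y : ℝ} (hd : 0 < d) (hd1 : d < 1 / 2) (hx : 0 ≤ x) (hxy : x ≤ y) :
    arfimaACVF d y ≤ arfimaACVF d x := by
  refine mul_le_mul_of_nonneg_left ?_ (arfima_const_pos hd (by linarith)).le
  refine setIntegral_mono_on (integrableOn_exp_mul_arfimaKernel hd hd1 (hx.trans hxy))
    (integrableOn_exp_mul_arfimaKernel hd hd1 hx) measurableSet_Ioi fun u hu => ?_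
  have hu0 : (0 : ℝ) < u := hu
  have := arfimaKernel_pos (d := d) hu0
  gcongr

/-- The leading constant of the autocovariances of `(1 - B) ^ (-d) ε`. -/
noncomputable def arfimaConst (d : ℝ) : ℝ :=
  (Real.Gamma d * Real.Gamma (1 - d))⁻¹ * Real.Gamma (1 - 2 * d)

lemma arfimaACVF_le {d x : ℝ} (hd : 0 < d) (hd1 : d < 1 / 2) (hx : 0 < x) :
    arfimaACVF d x ≤ arfimaConst d * x ^ (2 * d - 1) := by
  have h := integral_exp_mul_rpow (s := -(2 * d)) (by linarith) hx
  rw [show -(-(2 * d) + 1) = 2 * d - 1 by ring, show -(2 * d) + 1 = 1 - 2 * d by ring] at h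
  rw [arfimaConst, mul_assoc, ← h]
  refine mul_le_mul_of_nonneg_left ?_ (arfima_const_pos hd (by linarith)).le
  refine setIntegral_mono_on (integrableOn_exp_mul_arfimaKernel hd hd1 hx.le)
    (integrableOn_exp_mul_rpow (by linarith) hx) measurableSet_Ioi fun u hu => ?_
  gcongr
  exact arfimaKernel_le hd hu

/-- The constant in the error bounds for the autocovariances of `(1 - B) ^ (-d) ε`. -/
noncomputable def arfimaErr (d : ℝ) : ℝ :=
  (Real.Gamma d * Real.Gamma (1 - d))⁻¹ * Real.Gamma (3 - 2 * d)

lemma le_arfimaACVF {d x : ℝ} (hd : 0 < d) (hd1 : d < 1 / 2) (hx : 0 < x) :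
    arfimaConst d * x ^ (2 * d - 1) - arfimaErr d * x ^ (2 * d - 3) ≤ arfimaACVF d x := by
  have h1 := integral_exp_mul_rpow (s := -(2 * d)) (by linarith) hx
  rw [show -(-(2 * d) + 1) = 2 * d - 1 by ring, show -(2 * d) + 1 = 1 - 2 * d by ring] at h1
  have h2 := integral_exp_mul_rpow (s := 2 - 2 * d) (by linarith) hx
  rw [show -(2 - 2 * d + 1) = 2 * d - 3 by ring, show 2 - 2 * d + 1 = 3 - 2 * d by ring] at h2
  have i1 := integrableOn_exp_mul_rpow (s := -(2 * d)) (by linarith) hx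
  have i2 := integrableOn_exp_mul_rpow (s := 2 - 2 * d) (by linarith) hx
  rw [arfimaConst, arfimaErr, mul_assoc, mul_assoc, ← h1, ← h2, ← mul_sub, ← integral_sub i1 i2]
  refine mul_le_mul_of_nonneg_left ?_ (arfima_const_pos hd (by linarith)).le
  refine setIntegral_mono_on (i1.sub i2) (integrableOn_exp_mul_arfimaKernel hd hd1 hx.le)
    measurableSet_Ioi fun u hu => ?_
  simp only [← mul_sub]
  gcongr
  exact le_arfimaKernel hd1 hu

/-- Under the Laplace transform the second difference becomes the factor `(1 - exp (-m u))²`, which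
lies between `0` and `(m u)²`; the `u²` raises the decay by two powers. -/
lemma abs_arfimaACVF_second_difference_le {d n m : ℝ} (hd : 0 < d) (hd1 : d < 1 / 2) (hm : 0 ≤ m)
    (hmn : m < n) :
    |arfimaACVF d (n + m) + arfimaACVF d (n - m) - 2 * arfimaACVF d n| ≤
      m ^ 2 * (arfimaErr d * (n - m) ^ (2 * d - 3)) := by
  have hx : 0 < n - m := by linarith
  have h2 := integral_exp_mul_rpow (s := 2 - 2 * d) (by linarith) hx
  rw [show -(2 - 2 * d + 1) = 2 * d - 3 by ring, show 2 - 2 * d + 1 = 3 - 2 * d by ring] at h2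
  have i2 := integrableOn_exp_mul_rpow (s := 2 - 2 * d) (by linarith) hx
  have j1 := integrableOn_exp_mul_arfimaKernel hd hd1 (show 0 ≤ n + m by linarith)
  have j2 := integrableOn_exp_mul_arfimaKernel hd hd1 hx.le
  have j3 := integrableOn_exp_mul_arfimaKernel hd hd1 (show 0 ≤ n by linarith)
  have hκ := arfima_const_pos hd (by linarith)
  have e : arfimaACVF d (n + m) + arfimaACVF d (n - m) - 2 * arfimaACVF d n =
      (Real.Gamma d * Real.Gamma (1 - d))⁻¹ * ∫ u in Set.Ioi (0 : ℝ),
        Real.exp (-((n - m) * u)) * (1 - Real.exp (-(m * u))) ^ 2 * arfimaKernel d u := by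
    have hs : ∫ u in Set.Ioi (0 : ℝ),
        Real.exp (-((n - m) * u)) * (1 - Real.exp (-(m * u))) ^ 2 * arfimaKernel d u =
        ∫ u in Set.Ioi (0 : ℝ), (Real.exp (-((n + m) * u)) * arfimaKernel d u +
          Real.exp (-((n - m) * u)) * arfimaKernel d u -
          2 * (Real.exp (-(n * u)) * arfimaKernel d u)) := by
      congr 1 with u
      rw [show -((n + m) * u) = -((n - m) * u) + -(m * u) + -(m * u) by ring,
        show -(n * u) = -((n - m) * u) + -(m * u) by ring, Real.exp_add, Real.exp_add]
      ring
    have j12 : IntegrableOn (fun u => Real.exp (-((n + m) * u)) * arfimaKernel d u +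
        Real.exp (-((n - m) * u)) * arfimaKernel d u) (Set.Ioi 0) := j1.add j2
    rw [hs, integral_sub j12 (j3.const_mul 2), integral_add j1 j2, integral_const_mul]
    simp only [arfimaACVF]
    ring
  rw [e, abs_of_nonneg (mul_nonneg hκ.le (setIntegral_nonneg measurableSet_Ioi fun u hu =>
    mul_nonneg (by positivity) (arfimaKernel_pos hu).le))]
  rw [show m ^ 2 * (arfimaErr d * (n - m) ^ (2 * d - 3)) =
      (Real.Gamma d * Real.Gamma (1 - d))⁻¹ *
        (m ^ 2 * (Real.Gamma (3 - 2 * d) * (n - m) ^ (2 * d - 3))) by rw [arfimaErr]; ring,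
    ← h2, ← integral_const_mul (m ^ 2)]
  refine mul_le_mul_of_nonneg_left ?_ hκ.le
  refine integral_mono_of_nonneg ?_ (i2.const_mul (m ^ 2)) ?_ <;>
    filter_upwards [ae_restrict_mem measurableSet_Ioi] with u hu
  · exact mul_nonneg (by positivity) (arfimaKernel_pos hu).le
  have hu0 : (0 : ℝ) < u := hu
  have h3 : 0 ≤ 1 - Real.exp (-(m * u)) := by
    have : Real.exp (-(m * u)) ≤ 1 := Real.exp_le_one_iff.mpr (by nlinarith)
    linarith
  have h4 : 1 - Real.exp (-(m * u)) ≤ m * u := by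
    linarith [Real.add_one_le_exp (-(m * u))]
  have h5 := (arfimaKernel_pos (d := d) hu0).le
  have h6 : u ^ (2 - 2 * d) = u ^ 2 * u ^ (-(2 * d)) := by
    rw [show 2 - 2 * d = (2 : ℕ) + -(2 * d) by push_cast; ring, Real.rpow_add hu0,
      Real.rpow_natCast]
  calc _ ≤ Real.exp (-((n - m) * u)) * (m * u) ^ 2 * u ^ (-(2 * d)) := by
        gcongr
        exact arfimaKernel_le hd hu0
    _ = _ := by rw [h6]; ring

end FracDiff

/-! ### Mean-square continuity of means and covariances. -/

section Covariance

variable {Ω ι : Type*} [MeasurableSpace Ω] {P : Measure Ω} {l : Filter ι}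

/-- The expectation of a product is continuous in mean square. -/
lemma tendsto_integral_mul_of_tendsto_eLpNorm {U V : ι → Ω → ℝ} {u v : Ω → ℝ}
    (hU : ∀ n, MemLp (U n) 2 P) (hV : ∀ n, MemLp (V n) 2 P) (hu : MemLp u 2 P) (hv : MemLp v 2 P)
    (hUu : Tendsto (fun n => eLpNorm (U n - u) 2 P) l (𝓝 0))
    (hVv : Tendsto (fun n => eLpNorm (V n - v) 2 P) l (𝓝 0)) :
    Tendsto (fun n => ∫ ω, U n ω * V n ω ∂P) l (𝓝 (∫ ω, u ω * v ω ∂P)) := by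
  have h1 := (Lp.tendsto_Lp_iff_tendsto_eLpNorm'' U hU u hu).mpr hUu
  have h2 := (Lp.tendsto_Lp_iff_tendsto_eLpNorm'' V hV v hv).mpr hVv
  have e : ∀ {f g : Ω → ℝ} (hf : MemLp f 2 P) (hg : MemLp g 2 P),
      inner ℝ (hf.toLp f) (hg.toLp g) = ∫ ω, f ω * g ω ∂P := by
    intro f g hf hg
    rw [L2.inner_def]
    refine integral_congr_ae ?_
    filter_upwards [hf.coeFn_toLp, hg.coeFn_toLp] with ω h3 h4
    rw [h3, h4, real_inner_eq_re_inner]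
    simp [mul_comm]
  have h3 := h1.inner (𝕜 := ℝ) h2
  simpa only [e] using h3

lemma tendsto_integral_of_tendsto_eLpNorm [IsProbabilityMeasure P] {U : ι → Ω → ℝ} {u : Ω → ℝ}
    (hU : ∀ n, MemLp (U n) 2 P) (hu : MemLp u 2 P)
    (hUu : Tendsto (fun n => eLpNorm (U n - u) 2 P) l (𝓝 0)) :
    Tendsto (fun n => ∫ ω, U n ω ∂P) l (𝓝 (∫ ω, u ω ∂P)) := by
  have h1 : MemLp (fun _ : Ω => (1 : ℝ)) 2 P := memLp_const 1
  simpa using tendsto_integral_mul_of_tendsto_eLpNorm (V := fun _ _ => (1 : ℝ)) (v := fun _ => 1)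
    hU (fun _ => h1) hu h1 hUu (by simpa using tendsto_const_nhds)

lemma tendsto_covariance_of_tendsto_eLpNorm [IsProbabilityMeasure P]
    {U V : ι → Ω → ℝ} {u v : Ω → ℝ}
    (hU : ∀ n, MemLp (U n) 2 P) (hV : ∀ n, MemLp (V n) 2 P) (hu : MemLp u 2 P) (hv : MemLp v 2 P)
    (hUu : Tendsto (fun n => eLpNorm (U n - u) 2 P) l (𝓝 0))
    (hVv : Tendsto (fun n => eLpNorm (V n - v) 2 P) l (𝓝 0)) :
    Tendsto (fun n => covariance (U n) (V n) P) l (𝓝 (covariance u v P)) := by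
  simp only [fun n => covariance_eq_sub (hU n) (hV n), covariance_eq_sub hu hv]
  exact (tendsto_integral_mul_of_tendsto_eLpNorm hU hV hu hv hUu hVv).sub
    ((tendsto_integral_of_tendsto_eLpNorm hU hu hUu).mul
      (tendsto_integral_of_tendsto_eLpNorm hV hv hVv))

end Covariance

/-! ### Double sums over the lags of a sequence. -/

section LaggedSums

/-- Extension by zero of a sequence to the integers. -/
noncomputable def extendZero (a : ℕ → ℝ) (i : ℤ) : ℝ := if 0 ≤ i then a i.toNat else 0

lemma extendZero_natCast (a : ℕ → ℝ) (i : ℕ) : extendZero a i = a i := by simp [extendZero]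

lemma extendZero_of_notMem_range (a : ℕ → ℝ) {i : ℤ} (hi : i ∉ Set.range ((↑) : ℕ → ℤ)) :
    extendZero a i = 0 := by
  refine if_neg fun h => hi ⟨i.toNat, Int.toNat_of_nonneg h⟩

lemma hasSum_extendZero_mul {a G : ℕ → ℝ}
    (haG : ∀ k : ℕ, HasSum (fun i : ℕ => a i * a (i + k)) (G k)) (l : ℤ) :
    HasSum (fun i : ℤ => extendZero a i * extendZero a (i + l)) (G l.natAbs) := by
  have hnat : ∀ k : ℕ, HasSum (fun i : ℤ => extendZero a i * extendZero a (i + k)) (G k) := by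
    intro k
    rw [← Nat.cast_injective.hasSum_iff (f := fun i : ℤ => extendZero a i * extendZero a (i + k))]
    · convert! haG k using 2 with i
    · intro i hi
      rw [extendZero_of_notMem_range a hi, zero_mul]
  obtain ⟨k, rfl | rfl⟩ := Int.eq_nat_or_neg l
  · simpa using hnat k
  · rw [← (Equiv.addRight (k : ℤ)).hasSum_iff]
    simpa [Function.comp_def, mul_comm] using hnat k

/-- The double sum of a summable sequence over the lags of a square summable sequence. -/
lemma hasSum_mul_mul_lag {a G : ℕ → ℝ} {γ : ℤ → ℝ} (ha : ∀ i, 0 ≤ a i)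
    (haG : ∀ k : ℕ, HasSum (fun i : ℕ => a i * a (i + k)) (G k)) (hG : ∀ k, G k ≤ G 0)
    (hγ : Summable fun m => |γ m|) (k : ℤ) :
    HasSum (fun p : ℕ × ℕ => a p.1 * a p.2 * γ (k + p.1 - p.2))
      (∑' m, γ m * G (k - m).natAbs) := by
  have hα : ∀ i, 0 ≤ extendZero a i := fun i => by
    unfold extendZero; split_ifs
    exacts [ha _, le_rfl]
  have hG0 : ∀ k, 0 ≤ G k := fun k => (haG k).nonneg fun i => mul_nonneg (ha _) (ha _)
  set f : ℤ × ℤ → ℝ := fun p => γ p.1 * (extendZero a p.2 * extendZero a (p.2 + (k - p.1)))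
  have hf : ∀ m, HasSum (fun i => f (m, i)) (γ m * G (k - m).natAbs) := fun m =>
    (hasSum_extendZero_mul haG (k - m)).mul_left (γ m)
  have hf' : ∀ m, HasSum (fun i => ‖f (m, i)‖) (|γ m| * G (k - m).natAbs) := fun m => by
    convert! (hasSum_extendZero_mul haG (k - m)).mul_left |γ m| using 2 with i
    rw [Real.norm_eq_abs, abs_mul, abs_of_nonneg (mul_nonneg (hα _) (hα _))]
  have hfs : Summable f := by
    refine Summable.of_norm ((summable_prod_of_nonneg fun p => norm_nonneg _).mpr
      ⟨fun m => (hf' m).summable, ?_⟩)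
    refine Summable.of_nonneg_of_le (fun m => tsum_nonneg fun i => norm_nonneg _) (fun m => ?_)
      (hγ.mul_right (G 0))
    rw [(hf' m).tsum_eq]
    exact mul_le_mul_of_nonneg_left (hG _) (abs_nonneg _)
  have h1 : HasSum f (∑' m, γ m * G (k - m).natAbs) := by
    rw [(hfs.hasSum.prod_fiberwise hf).tsum_eq]
    exact hfs.hasSum
  -- From indices `(i, j)` to (lag of `γ`, first index): with `m = k + i - j` one has `i + (k - m) =
  -- j`.
  let e : ℤ × ℤ ≃ ℤ × ℤ :=
    { toFun := fun p => (k + p.1 - p.2, p.1)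
      invFun := fun p => (p.2, k + p.2 - p.1)
      left_inv := fun p => by ext <;> simp
      right_inv := fun p => by ext <;> simp }
  rw [← e.hasSum_iff] at h1
  have hinj : Function.Injective (Prod.map ((↑) : ℕ → ℤ) ((↑) : ℕ → ℤ)) :=
    Nat.cast_injective.prodMap Nat.cast_injective
  rw [← hinj.hasSum_iff] at h1
  · convert! h1 using 2 with p
    simp only [Function.comp, e, f, Equiv.coe_fn_mk, Prod.map]
    rw [show (p.1 : ℤ) + (k - (k + p.1 - p.2)) = (p.2 : ℤ) by ring, extendZero_natCast,
      extendZero_natCast]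
    ring
  · rintro ⟨i, j⟩ hij
    simp only [Function.comp, e, f, Equiv.coe_fn_mk]
    rw [show i + (k - (k + i - j)) = j by ring]
    by_cases hi : i ∈ Set.range ((↑) : ℕ → ℤ)
    · have hj : j ∉ Set.range ((↑) : ℕ → ℤ) := by
        rintro ⟨j', rfl⟩
        obtain ⟨i', rfl⟩ := hi
        exact hij ⟨(i', j'), rfl⟩
      rw [extendZero_of_notMem_range a hj, mul_zero, mul_zero]
    · rw [extendZero_of_notMem_range a hi, zero_mul, mul_zero]

/-- The squares are cofinal among the finite sets of pairs, so unconditional convergence gives the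
limit of the covariances of the partial sums. -/
lemma tendsto_sum_range_sum_range {f : ℕ × ℕ → ℝ} {s : ℝ} (hf : HasSum f s) :
    Tendsto (fun N : ℕ => ∑ i ∈ Finset.range N, ∑ j ∈ Finset.range N, f (i, j)) atTop (𝓝 s) := by
  have h := hf.comp (tendsto_finsetProd_atTop.comp
    (tendsto_finset_range.prodMk tendsto_finset_range |>.mono_right prod_atTop_atTop_eq.le))
  simpa [Function.comp_def, Finset.sum_product] using h

end LaggedSums

/-! ### Stationarity and covariances of the differenced process. -/

namespace FracDiff

variable {Ω : Type*} [MeasurableSpace Ω] {P : Measure Ω}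
  {Y X : ℤ → Ω → ℝ}

lemma SecondOrderStationary.covariance_eq_acvf (hY : SecondOrderStationary Y P) (s t : ℤ) :
    covariance (Y s) (Y t) P = acvf Y P (t - s) := by
  have := hY.cov_eq s 0 (t - s)
  rwa [add_sub_cancel, zero_add] at this

lemma IsFractionalDifference.tendsto_eLpNorm {D : ℝ} (hX : IsFractionalDifference D Y X P) (t : ℤ) :
    Tendsto (fun N : ℕ => eLpNorm
      ((fun ω => ∑ j ∈ Finset.range N, diffCoeff D j * Y (t - j) ω) - X t) 2 P) atTop (𝓝 0) := by
  simp_rw [fun N : ℕ => eLpNorm_sub_comm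
    (fun ω => ∑ j ∈ Finset.range N, diffCoeff D j * Y (t - j) ω) (X t) 2 P]
  exact (hX t).2

lemma memLp_sum_diffCoeff (hY : SecondOrderStationary Y P) (D : ℝ) (t : ℤ) (N : ℕ) :
    MemLp (fun ω => ∑ j ∈ Finset.range N, diffCoeff D j * Y (t - j) ω) 2 P :=
  memLp_finsetSum _ fun _ _ => (hY.memLp _).const_mul _

lemma IsFractionalDifference.tendsto_covariance [IsProbabilityMeasure P] {D : ℝ} (hX : IsFractionalDifference D Y X P)
    (hY : SecondOrderStationary Y P) (t k : ℤ) :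
    Tendsto (fun N : ℕ => ∑ i ∈ Finset.range N, ∑ j ∈ Finset.range N,
      diffCoeff D i * diffCoeff D j * acvf Y P (k + i - j)) atTop
      (𝓝 (covariance (X t) (X (t + k)) P)) := by
  have h := tendsto_covariance_of_tendsto_eLpNorm (memLp_sum_diffCoeff hY D t)
    (memLp_sum_diffCoeff hY D (t + k)) (hX t).1 (hX (t + k)).1 (hX.tendsto_eLpNorm t)
    (hX.tendsto_eLpNorm (t + k))
  refine h.congr fun N => ?_
  rw [covariance_fun_sum_fun_sum' (fun i _ => (hY.memLp _).const_mul _)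
    (fun j _ => (hY.memLp _).const_mul _)]
  refine Finset.sum_congr rfl fun i _ => Finset.sum_congr rfl fun j _ => ?_
  rw [covariance_const_mul_left, covariance_const_mul_right, hY.covariance_eq_acvf,
    show t + k - j - (t - i) = k + i - j by ring, mul_assoc]

/-- A fractionally differenced stationary process is stationary. -/
lemma IsFractionalDifference.secondOrderStationary [IsProbabilityMeasure P] {D : ℝ}
    (hX : IsFractionalDifference D Y X P) (hY : SecondOrderStationary Y P) : SecondOrderStationary X P where
  memLp t := (hX t).1
  mean_eq := by
    have key : ∀ t, Tendsto (fun N : ℕ => ∑ j ∈ Finset.range N,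
        diffCoeff D j * ∫ ω, Y 0 ω ∂P) atTop (𝓝 (∫ ω, X t ω ∂P)) := by
      intro t
      refine (tendsto_integral_of_tendsto_eLpNorm (memLp_sum_diffCoeff hY D t) (hX t).1
        (hX.tendsto_eLpNorm t)).congr fun N => ?_
      rw [integral_finsetSum _ fun j _ => ((hY.memLp _).const_mul _).integrable one_le_two]
      refine Finset.sum_congr rfl fun j _ => ?_
      rw [integral_const_mul, hY.mean_eq _ 0]
    exact fun s t => tendsto_nhds_unique (key s) (key t)
  cov_eq s t k := tendsto_nhds_unique (hX.tendsto_covariance hY s k) (hX.tendsto_covariance hY t k)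

lemma acvf_eq_tsum [IsProbabilityMeasure P] {d : ℝ} (hd : 0 < d) (hd1 : d < 1 / 2)
    (hX : IsFractionalDifference (-d) Y X P) (hY : SecondOrderStationary Y P)
    (hγ : Summable fun m => |acvf Y P m|) (k : ℤ) :
    acvf X P k = ∑' m, acvf Y P m * arfimaACVF d (k - m).natAbs := by
  have h1 := hX.tendsto_covariance hY 0 k
  rw [zero_add] at h1
  have h3 : ∀ n : ℕ, arfimaACVF d n ≤ arfimaACVF d (0 : ℕ) := fun n =>
    arfimaACVF_anti hd hd1 (by simp) (by simp)
  have h2 := hasSum_mul_mul_lag (a := diffCoeff (-d)) (G := fun n : ℕ => arfimaACVF d n)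
    (γ := acvf Y P) (fun i => (diffCoeff_neg_pos hd i).le) (hasSum_diffCoeff_mul_diffCoeff hd hd1)
    h3 hγ k
  have h4 := tendsto_sum_range_sum_range h2
  exact tendsto_nhds_unique h1 h4

end FracDiff

/-! ### The convolution estimate. -/

namespace FracDiff

lemma sum_range_arfimaACVF_le {d : ℝ} (hd : 0 < d) (hd1 : d < 1 / 2) (n : ℕ) :
    ∑ l ∈ Finset.range (n + 1), arfimaACVF d l ≤
      arfimaACVF d 0 + arfimaConst d / (2 * d) * (n : ℝ) ^ (2 * d) := by
  induction n with
  | zero => simp [Real.zero_rpow (show 2 * d ≠ 0 by positivity)]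
  | succ n ih =>
    rw [Finset.sum_range_succ]
    have hn : (0 : ℝ) < ((n + 1 : ℕ) : ℝ) := by positivity
    have hA : 0 < arfimaConst d :=
      mul_pos (arfima_const_pos hd (by linarith)) (Real.Gamma_pos_of_pos (by linarith))
    have h1 := arfimaACVF_le hd hd1 hn
    set y : ℝ := ((n + 1 : ℕ) : ℝ) with hy
    have h2 : (n : ℝ) = y * (1 + -1 / y) := by
      rw [hy]; push_cast; field_simp; ring
    have h1y : (1 : ℝ) ≤ y := by rw [hy]; push_cast; linarith [n.cast_nonneg (α := ℝ)]
    have h3 : -1 ≤ -1 / y := by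
      rw [le_div_iff₀ hn]; linarith
    have h4 : (n : ℝ) ^ (2 * d) ≤ y ^ (2 * d) - 2 * d * y ^ (2 * d - 1) := by
      rw [h2, Real.mul_rpow hn.le (by linarith)]
      -- Bernoulli's inequality with exponent `2d ∈ [0, 1]` bounds `2d y^(2d-1)` by the increment of
      -- `y^(2d)`, so the sum telescopes.
      have h5 := rpow_one_add_le_one_add_mul_self h3 (p := 2 * d) (by linarith) (by linarith)
      calc _ ≤ y ^ (2 * d) * (1 + 2 * d * (-1 / y)) := by gcongr
        _ = _ := by rw [Real.rpow_sub hn, Real.rpow_one]; ring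
    have h6 : arfimaConst d * y ^ (2 * d - 1) ≤
        arfimaConst d / (2 * d) * (y ^ (2 * d) - (n : ℝ) ^ (2 * d)) := by
      rw [div_mul_eq_mul_div, le_div_iff₀ (by positivity)]
      nlinarith
    linarith

/-- The sum of the autocovariances of `(1 - B) ^ (-d) ε` over the lags below `n`. -/
lemma hasSum_truncated_arfimaACVF (d : ℝ) (n : ℕ) :
    HasSum (fun l : ℤ => if l.natAbs < n then arfimaACVF d l.natAbs else 0)
      (∑ l ∈ Finset.range n, arfimaACVF d l + ∑ l ∈ Finset.range n, arfimaACVF d l -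
        if 0 < n then arfimaACVF d 0 else 0) := by
  have h : HasSum (fun l : ℕ => if l < n then arfimaACVF d l else 0)
      (∑ l ∈ Finset.range n, arfimaACVF d l) := by
    have h0 := hasSum_sum_of_ne_finset_zero (L := .unconditional ℕ)
      (f := fun l : ℕ => if l < n then arfimaACVF d l else 0) (s := Finset.range n)
      (fun l hl => if_neg (by simpa using hl))
    convert! h0 using 1
    exact Finset.sum_congr rfl fun l hl => (if_pos (Finset.mem_range.mp hl)).symm
  -- Lag `0` occurs in both halves and is subtracted once.
  have := HasSum.of_nat_of_neg
    (f := fun l : ℤ => if l.natAbs < n then arfimaACVF d l.natAbs else 0)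
    (by simpa using h) (by simpa using h)
  simpa using this

lemma exists_truncated_arfimaACVF_bound {d : ℝ} (hd : 0 < d) (hd1 : d < 1 / 2) :
    ∃ D, 0 ≤ D ∧ ∀ n : ℕ, 1 ≤ n → ∃ s ≤ D * (n : ℝ) ^ (2 * d),
      HasSum (fun l : ℤ => if l.natAbs < n then arfimaACVF d l.natAbs else 0) s := by
  have hA : 0 < arfimaConst d :=
    mul_pos (arfima_const_pos hd (by linarith)) (Real.Gamma_pos_of_pos (by linarith))
  have hG0 := fun x => arfimaACVF_nonneg hd (by linarith) x
  refine ⟨2 * (arfimaACVF d 0 + arfimaConst d / (2 * d)), ?_, fun n hn => ⟨_, ?_,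
    hasSum_truncated_arfimaACVF d n⟩⟩
  · have := hG0 0
    positivity
  have h1 := sum_range_arfimaACVF_le hd hd1 n
  rw [Finset.sum_range_succ] at h1
  have h2 : (1 : ℝ) ≤ (n : ℝ) ^ (2 * d) :=
    Real.one_le_rpow (by exact_mod_cast hn) (by linarith)
  rw [if_pos (by omega)]
  nlinarith [hG0 0, hG0 n]

lemma rpow_sub_three {n : ℝ} (hn : 0 < n) (d : ℝ) :
    n ^ (2 * d - 3) = n ^ (2 * d - 1) / n ^ 2 ∧ n ^ (2 * d - 3) = n ^ (2 * d) / n ^ 3 := by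
  constructor
  · rw [show 2 * d - 3 = 2 * d - 1 - (2 : ℕ) by push_cast; ring, Real.rpow_sub hn,
      Real.rpow_natCast]
  · rw [show 2 * d - 3 = 2 * d - (3 : ℕ) by push_cast; ring, Real.rpow_sub hn,
      Real.rpow_natCast]

variable {d C : ℝ} {γ : ℤ → ℝ}

/-- If `|l| ≥ n`, the covariance is at most `A n^(2d-1)`, and `n² ≤ 4m²` trades two powers of `n`
for the second moment of `γ`. If `|l| < n`, only `|γ m| ≤ 8C/n³` is small; the covariance is kept,
since its sum over `|l| < n` is `O(n^(2d))`. -/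
lemma far_term_le (hd : 0 < d) (hd1 : d < 1 / 2) (hC : ∀ k : ℤ, |(k : ℝ)| ^ 3 * |γ k| ≤ C)
    {n : ℕ} (hn : 1 ≤ n) {m l : ℤ} (hm : (n : ℝ) < 2 * |(m : ℝ)|) :
    |γ m| * arfimaACVF d l.natAbs ≤
      4 * arfimaConst d * ((m : ℝ) ^ 2 * |γ m|) * (n : ℝ) ^ (2 * d - 3) +
        8 * C / (n : ℝ) ^ 3 * if l.natAbs < n then arfimaACVF d l.natAbs else 0 := by
  have hA : 0 < arfimaConst d :=
    mul_pos (arfima_const_pos hd (by linarith)) (Real.Gamma_pos_of_pos (by linarith))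
  have hn0 : (0 : ℝ) < n := by exact_mod_cast hn
  have hG0 := arfimaACVF_nonneg hd (by linarith) (l.natAbs : ℝ)
  split_ifs with hl
  · have h1 : |γ m| ≤ 8 * C / (n : ℝ) ^ 3 := by
      rw [le_div_iff₀ (by positivity)]
      have h2 : (n : ℝ) ^ 3 ≤ (2 * |(m : ℝ)|) ^ 3 := by gcongr
      nlinarith [hC m, mul_le_mul_of_nonneg_left h2 (abs_nonneg (γ m))]
    have := mul_le_mul_of_nonneg_right h1 hG0
    have : 0 ≤ 4 * arfimaConst d * ((m : ℝ) ^ 2 * |γ m|) * (n : ℝ) ^ (2 * d - 3) := by positivity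
    linarith
  · push Not at hl
    have hl' : (n : ℝ) ≤ l.natAbs := by exact_mod_cast hl
    have h1 : arfimaACVF d l.natAbs ≤ arfimaConst d * (n : ℝ) ^ (2 * d - 1) :=
      (arfimaACVF_anti hd hd1 hn0.le hl').trans (arfimaACVF_le hd hd1 hn0)
    have h2 : (n : ℝ) ^ 2 ≤ 4 * (m : ℝ) ^ 2 := by
      rw [← sq_abs (m : ℝ)]; nlinarith
    rw [mul_zero, add_zero, (rpow_sub_three hn0 d).1, ← mul_div_assoc, le_div_iff₀ (by positivity)]
    calc |γ m| * arfimaACVF d l.natAbs * (n : ℝ) ^ 2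
        ≤ |γ m| * (arfimaConst d * (n : ℝ) ^ (2 * d - 1)) * (4 * (m : ℝ) ^ 2) := by gcongr
      _ = _ := by ring

/-- Here `n - |m| ≥ n/2`, so the second-difference bound loses at most the factor `2^(3-2d) ≤ 8`. -/
lemma near_term_le (hd : 0 < d) (hd1 : d < 1 / 2) {n : ℕ} (hn : 1 ≤ n) {m : ℤ}
    (hm : 2 * |(m : ℝ)| ≤ n) :
    |arfimaACVF d (n + m : ℤ).natAbs + arfimaACVF d (n - m : ℤ).natAbs - 2 * arfimaACVF d n| ≤
      8 * arfimaErr d * (m : ℝ) ^ 2 * (n : ℝ) ^ (2 * d - 3) := by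
  have hn0 : (0 : ℝ) < n := by exact_mod_cast hn
  have hE : 0 < arfimaErr d :=
    mul_pos (arfima_const_pos hd (by linarith)) (Real.Gamma_pos_of_pos (by linarith))
  have key : |arfimaACVF d (n + |(m : ℝ)|) + arfimaACVF d (n - |(m : ℝ)|) - 2 * arfimaACVF d n| ≤
      8 * arfimaErr d * (m : ℝ) ^ 2 * (n : ℝ) ^ (2 * d - 3) := by
    have h := abs_arfimaACVF_second_difference_le hd hd1 (abs_nonneg (m : ℝ))
      (show |(m : ℝ)| < n by linarith)
    have h1 : (n - |(m : ℝ)|) ^ (2 * d - 3) ≤ 8 * (n : ℝ) ^ (2 * d - 3) := by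
      calc (n - |(m : ℝ)|) ^ (2 * d - 3) ≤ ((n : ℝ) / 2) ^ (2 * d - 3) :=
            Real.rpow_le_rpow_of_nonpos (by positivity) (by linarith) (by linarith)
        _ = 2 ^ (3 - 2 * d) * (n : ℝ) ^ (2 * d - 3) := by
            rw [Real.div_rpow hn0.le two_pos.le, div_eq_mul_inv, ← Real.rpow_neg two_pos.le,
              neg_sub, mul_comm]
        _ ≤ 2 ^ (3 : ℝ) * (n : ℝ) ^ (2 * d - 3) := by
            gcongr <;> linarith
        _ = _ := by norm_num
    rw [sq_abs] at h
    calc _ ≤ _ := h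
      _ ≤ (m : ℝ) ^ 2 * (arfimaErr d * (8 * (n : ℝ) ^ (2 * d - 3))) := by gcongr
      _ = _ := by ring
  have e1 : (((n + m : ℤ).natAbs : ℕ) : ℝ) = n + m := by
    rw [Nat.cast_natAbs, Int.cast_abs, abs_of_nonneg] <;> push_cast
    · rfl
    · linarith [neg_abs_le (m : ℝ), abs_nonneg (m : ℝ)]
  have e2 : (((n - m : ℤ).natAbs : ℕ) : ℝ) = n - m := by
    rw [Nat.cast_natAbs, Int.cast_abs, abs_of_nonneg] <;> push_cast
    · rfl
    · linarith [le_abs_self (m : ℝ), abs_nonneg (m : ℝ)]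
  rw [e1, e2]
  rcases abs_cases (m : ℝ) with ⟨h, _⟩ | ⟨h, _⟩ <;> rw [h] at key
  · exact key
  · rw [sub_neg_eq_add, ← sub_eq_add_neg] at key
    rwa [add_comm (arfimaACVF d (n + m))]

/-- Convolution of the autocovariances of `(1 - B) ^ (-d) ε` with a sequence having a finite
second moment multiplies them by the sum of the sequence, up to `O(n ^ (2 * d - 3))`. -/
lemma exists_convolution_bound (hd : 0 < d) (hd1 : d < 1 / 2) (hneg : ∀ k, γ (-k) = γ k)
    (hC : ∀ k : ℤ, |(k : ℝ)| ^ 3 * |γ k| ≤ C)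
    (hs2 : Summable fun k : ℤ => (k : ℝ) ^ 2 * |γ k|) (hs : Summable fun k => |γ k|) :
    ∃ B, ∀ n : ℕ, 1 ≤ n →
      |∑' m, γ m * arfimaACVF d ((n : ℤ) - m).natAbs -
        (∑' m, γ m) * (arfimaConst d * (n : ℝ) ^ (2 * d - 1))| ≤ B * (n : ℝ) ^ (2 * d - 3) := by
  obtain ⟨D, hD, hDs⟩ := exists_truncated_arfimaACVF_bound hd hd1
  have hA : 0 < arfimaConst d :=
    mul_pos (arfima_const_pos hd (by linarith)) (Real.Gamma_pos_of_pos (by linarith))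
  have hE : 0 < arfimaErr d :=
    mul_pos (arfima_const_pos hd (by linarith)) (Real.Gamma_pos_of_pos (by linarith))
  have hC0 : 0 ≤ C := (by positivity : (0 : ℝ) ≤ |((0 : ℤ) : ℝ)| ^ 3 * |γ 0|).trans (hC 0)
  have hG := fun x => arfimaACVF_nonneg hd (by linarith) x
  set M := ∑' k : ℤ, (k : ℝ) ^ 2 * |γ k|
  -- `4E` is half the near bound; `8A` is half of `4A + 4A + 2 · 4A` from the far lags `n + m`, `n -
  -- m` and `n`; `8CD` comes from the two truncated sums; the last term replaces `G(n)` by its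
  -- leading term.
  refine ⟨(4 * arfimaErr d + 8 * arfimaConst d) * M + 8 * C * D + |∑' m, γ m| * arfimaErr d,
    fun n hn => ?_⟩
  have hn0 : (0 : ℝ) < n := by exact_mod_cast hn
  obtain ⟨s, hsD, hψ⟩ := hDs n hn
  set ψ : ℤ → ℝ := fun l => if l.natAbs < n then arfimaACVF d l.natAbs else 0 with hψdef
  have hψ0 : ∀ l, 0 ≤ ψ l := fun l => by
    simp only [hψdef]; split_ifs
    exacts [hG _, le_rfl]
  have hsub : HasSum (fun m : ℤ => ψ (n - m)) s := by
    rw [← (Equiv.subLeft (n : ℤ)).hasSum_iff] at hψ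
    exact hψ
  have hadd : HasSum (fun m : ℤ => ψ (n + m)) s := by
    rw [← (Equiv.addLeft (n : ℤ)).hasSum_iff] at hψ
    exact hψ
  have hbd : ∀ l : ℤ → ℤ, Summable fun m => γ m * arfimaACVF d (l m).natAbs := by
    intro l
    refine Summable.of_norm_bounded (hs.mul_right (arfimaACVF d 0)) fun m => ?_
    rw [norm_mul, Real.norm_eq_abs, Real.norm_of_nonneg (hG _)]
    exact mul_le_mul_of_nonneg_left (arfimaACVF_anti hd hd1 le_rfl (by positivity)) (abs_nonneg _)
  have hsym : ∑' m, γ m * arfimaACVF d ((n : ℤ) + m).natAbs =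
      ∑' m, γ m * arfimaACVF d ((n : ℤ) - m).natAbs := by
    rw [← (Equiv.neg ℤ).tsum_eq]
    simp [hneg, sub_eq_add_neg]
  have hγ : Summable γ := hs.of_abs
  -- Averaging over `m` and `-m`, as evenness of `γ` permits, turns first differences into second
  -- differences.
  have hcenter : ∑' m, γ m * arfimaACVF d ((n : ℤ) - m).natAbs - (∑' m, γ m) * arfimaACVF d n =
      ∑' m, γ m * ((arfimaACVF d ((n : ℤ) + m).natAbs + arfimaACVF d ((n : ℤ) - m).natAbs -
        2 * arfimaACVF d n) / 2) := by
    have e : ∀ m, γ m * ((arfimaACVF d ((n : ℤ) + m).natAbs + arfimaACVF d ((n : ℤ) - m).natAbs -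
        2 * arfimaACVF d n) / 2) = (γ m * arfimaACVF d ((n : ℤ) + m).natAbs +
        γ m * arfimaACVF d ((n : ℤ) - m).natAbs) / 2 - γ m * arfimaACVF d n := fun m => by ring
    simp_rw [e]
    rw [Summable.tsum_sub (((hbd _).add (hbd _)).div_const 2) (hγ.mul_right _), tsum_div_const,
      Summable.tsum_add (hbd _) (hbd _), hsym, tsum_mul_right]
    ring
  set K := (n : ℝ) ^ (2 * d - 3) with hK
  have hK0 : 0 < K := Real.rpow_pos_of_pos hn0 _
  have hterm : ∀ m : ℤ, ‖γ m * ((arfimaACVF d ((n : ℤ) + m).natAbs +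
      arfimaACVF d ((n : ℤ) - m).natAbs - 2 * arfimaACVF d n) / 2)‖ ≤
      (4 * arfimaErr d + 8 * arfimaConst d) * K * ((m : ℝ) ^ 2 * |γ m|) +
        4 * C / (n : ℝ) ^ 3 * (ψ (n + m) + ψ (n - m)) := by
    intro m
    have hw : 0 ≤ (m : ℝ) ^ 2 * |γ m| := by positivity
    have hψp := hψ0 (n + m)
    have hψm := hψ0 (n - m)
    have hq : 0 ≤ 4 * C / (n : ℝ) ^ 3 * (ψ (n + m) + ψ (n - m)) := by positivity
    rw [Real.norm_eq_abs, abs_mul, abs_div, abs_two]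
    rcases le_or_gt (2 * |(m : ℝ)|) n with hm | hm
    · have h1 := near_term_le hd hd1 hn hm
      have h2 := mul_le_mul_of_nonneg_left h1 (abs_nonneg (γ m))
      have h3 : 0 ≤ 8 * arfimaConst d * K * ((m : ℝ) ^ 2 * |γ m|) := by positivity
      rw [← hK] at h2
      linarith
    · have h1 := far_term_le (l := n + m) hd hd1 hC hn hm
      have h2 := far_term_le (l := n - m) hd hd1 hC hn hm
      have h3 := far_term_le (l := n) hd hd1 hC hn hm
      -- The truncation is strict, so its term vanishes at the lag `n` itself.
      simp only [Int.natAbs_natCast, lt_irrefl, if_false, mul_zero, add_zero] at h3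
      rw [← hK] at h1 h2 h3
      have h4 : |arfimaACVF d ((n : ℤ) + m).natAbs + arfimaACVF d ((n : ℤ) - m).natAbs -
          2 * arfimaACVF d n| ≤ arfimaACVF d ((n : ℤ) + m).natAbs +
          arfimaACVF d ((n : ℤ) - m).natAbs + 2 * arfimaACVF d n := by
        rw [abs_le]
        constructor <;> linarith [hG (((n : ℤ) + m).natAbs : ℝ), hG (((n : ℤ) - m).natAbs : ℝ), hG n]
      have h5 := mul_le_mul_of_nonneg_left h4 (abs_nonneg (γ m))
      have h6 : 0 ≤ 4 * arfimaErr d * K * ((m : ℝ) ^ 2 * |γ m|) := by positivity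
      have h7 : 8 * C / (n : ℝ) ^ 3 * ψ (n + m) + 8 * C / (n : ℝ) ^ 3 * ψ (n - m) =
          2 * (4 * C / (n : ℝ) ^ 3 * (ψ (n + m) + ψ (n - m))) := by ring
      linarith
  have hmain := tsum_of_norm_bounded ((hs2.hasSum.mul_left
    ((4 * arfimaErr d + 8 * arfimaConst d) * K)).add
    ((hadd.add hsub).mul_left (4 * C / (n : ℝ) ^ 3))) hterm
  rw [← hcenter, Real.norm_eq_abs] at hmain
  have hlead : |arfimaACVF d n - arfimaConst d * (n : ℝ) ^ (2 * d - 1)| ≤ arfimaErr d * K := by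
    rw [abs_le]
    constructor <;> linarith [le_arfimaACVF hd hd1 hn0, arfimaACVF_le hd hd1 hn0,
      mul_pos hE hK0]
  have hfar : 4 * C / (n : ℝ) ^ 3 * (s + s) ≤ 8 * C * D * K := by
    rw [hK, (rpow_sub_three hn0 d).2]
    calc _ ≤ 4 * C / (n : ℝ) ^ 3 * (D * (n : ℝ) ^ (2 * d) + D * (n : ℝ) ^ (2 * d)) := by gcongr
      _ = _ := by ring
  have hlead' := mul_le_mul_of_nonneg_left hlead (abs_nonneg (∑' m, γ m))
  rw [← abs_mul] at hlead'
  have e : ∑' m, γ m * arfimaACVF d ((n : ℤ) - m).natAbs -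
      (∑' m, γ m) * (arfimaConst d * (n : ℝ) ^ (2 * d - 1)) =
      (∑' m, γ m * arfimaACVF d ((n : ℤ) - m).natAbs - (∑' m, γ m) * arfimaACVF d n) +
      (∑' m, γ m) * (arfimaACVF d n - arfimaConst d * (n : ℝ) ^ (2 * d - 1)) := by ring
  rw [e]
  refine (abs_add_le _ _).trans ?_
  linarith

end FracDiff

/-! ### Expansion for fractional Gaussian noise and matching of the constants. -/

namespace FracDiff

/-- The symmetric second difference of `x ^ s` at `1`, up to fourth order. -/
lemma isBigO_rpow_second_difference (s : ℝ) :
    (fun y : ℝ => (1 + y) ^ s + (1 - y) ^ s - 2 - s * (s - 1) * y ^ 2) =O[𝓝 0]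
      fun y => y ^ 4 := by
  have h1 := (Real.one_add_rpow_hasFPowerSeriesAt_zero (a := s)).isBigO_sub_partialSum_pow 4
  have h2 : Tendsto (fun y : ℝ => -y) (𝓝 0) (𝓝 0) := by
    simpa using (continuous_neg (G := ℝ)).tendsto 0
  have h3 := h1.comp_tendsto h2
  -- Adding the cubic Taylor polynomials at `y` and `-y` cancels the odd terms and leaves `2 + s(s -
  -- 1) y²`.
  have h4 := h1.add (h3.trans (by simpa [Function.comp_def] using isBigO_refl _ _))
  have hch : Ring.choose s 2 = s * (s - 1) / 2 := by
    have h := Ring.descPochhammer_eq_factorial_smul_choose s 2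
    rw [← Polynomial.aeval_eq_smeval] at h
    simp [descPochhammer_succ_right] at h
    linarith
  refine (h4.congr (fun y => ?_) (fun y => rfl)).trans ?_
  · simp [FormalMultilinearSeries.partialSum, Finset.sum_range_succ, binomialSeries,
      FormalMultilinearSeries.coeff_ofScalars, hch]
    ring_nf
  · simp_rw [← norm_pow]
    exact (isBigO_refl _ _).norm_left

lemma fgnACVF_isBigO (H V : ℝ) :
    (fun n : ℕ => fgnACVF H V n - V * H * (2 * H - 1) * (n : ℝ) ^ (2 * H - 2)) =O[atTop]
      fun n : ℕ => (n : ℝ) ^ (2 * H - 4) := by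
  have h1 := (isBigO_rpow_second_difference (2 * H)).comp_tendsto
    (tendsto_inv_atTop_nhds_zero_nat (𝕜 := ℝ))
  have h2 := ((isBigO_refl (fun n : ℕ => V / 2 * (n : ℝ) ^ (2 * H)) atTop).mul h1)
  refine (h2.congr' ?_ ?_).trans (isBigO_const_mul_self (V / 2) _ _)
  · filter_upwards [eventually_ge_atTop 1] with n hn
    have hn0 : (0 : ℝ) < n := by exact_mod_cast hn
    have hn1 : (1 : ℝ) ≤ n := by exact_mod_cast hn
    have e1 : |(n : ℝ) + 1| ^ (2 * H) = (n : ℝ) ^ (2 * H) * (1 + (n : ℝ)⁻¹) ^ (2 * H) := by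
      rw [← Real.mul_rpow hn0.le (by positivity), abs_of_pos (by positivity)]
      congr 1; field_simp
    have h3 : 0 ≤ 1 - (n : ℝ)⁻¹ := sub_nonneg.mpr (inv_le_one_of_one_le₀ hn1)
    have e2 : |(n : ℝ) - 1| ^ (2 * H) = (n : ℝ) ^ (2 * H) * (1 - (n : ℝ)⁻¹) ^ (2 * H) := by
      rw [← Real.mul_rpow hn0.le h3, abs_of_nonneg (by linarith)]
      congr 1; field_simp
    have e3 : (n : ℝ) ^ (2 * H - 2) = (n : ℝ) ^ (2 * H) * ((n : ℝ)⁻¹) ^ 2 := by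
      rw [show 2 * H - 2 = 2 * H - (2 : ℕ) by push_cast; ring, Real.rpow_sub hn0,
        Real.rpow_natCast, inv_pow, div_eq_mul_inv]
    simp only [fgnACVF, Function.comp, Int.cast_natCast]
    rw [e1, e2, e3, abs_of_pos hn0]
    ring
  · filter_upwards [eventually_ge_atTop 1] with n hn
    have hn0 : (0 : ℝ) < n := by exact_mod_cast hn
    simp only [Function.comp]
    rw [show 2 * H - 4 = 2 * H - (4 : ℕ) by push_cast; ring, Real.rpow_sub hn0,
      Real.rpow_natCast, inv_pow]
    ring

/-- Matching the spectral constants matches the leading terms of the autocovariances. -/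
lemma mul_arfimaConst_eq {H V : ℝ} (hH : H ∈ Set.Ioo (1 / 2 : ℝ) 1) {h : ℝ → ℝ}
    (hc : cf H h = cfStar H V) :
    h 0 * arfimaConst (H - 1 / 2) = V * H * (2 * H - 1) := by
  have hπ := Real.pi_pos
  have h0 : h 0 = 2 * V * H * Real.Gamma (2 * H) * Real.sin (H * Real.pi) := by
    rw [cf, cfStar, show 2 - 2 * H = 1 - 2 * H + 1 by ring, Real.rpow_add (by positivity),
      Real.rpow_one] at hc
    have hp : 0 < (2 * Real.pi) ^ (1 - 2 * H) := by positivity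
    apply mul_left_cancel₀ hp.ne'
    rw [hc]
    field_simp
  -- Reflection at `H - 1/2` and at `2H - 1`; the two sines are related by the double-angle formula,
  -- and all Gamma factors cancel.
  have hG1 := Real.Gamma_mul_Gamma_one_sub (H - 1 / 2)
  have hG2 := Real.Gamma_mul_Gamma_one_sub (2 * H - 1)
  have hG3 : Real.Gamma (2 * H) = (2 * H - 1) * Real.Gamma (2 * H - 1) := by
    rw [← Real.Gamma_add_one (by linarith [hH.1])]; ring_nf
  have hs1 : Real.sin (Real.pi * (H - 1 / 2)) = -Real.cos (H * Real.pi) := by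
    rw [show Real.pi * (H - 1 / 2) = H * Real.pi - Real.pi / 2 by ring, Real.sin_sub_pi_div_two]
  have hs2 : Real.sin (Real.pi * (2 * H - 1)) =
      -(2 * Real.sin (H * Real.pi) * Real.cos (H * Real.pi)) := by
    rw [show Real.pi * (2 * H - 1) = 2 * (H * Real.pi) - Real.pi by ring, Real.sin_sub_pi,
      Real.sin_two_mul]
  have hpos : 0 < Real.sin (Real.pi * (2 * H - 1)) :=
    Real.sin_pos_of_pos_of_lt_pi (by nlinarith [hH.1]) (by nlinarith [hH.2])
  rw [eq_div_iff hpos.ne', hs2] at hG2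
  rw [arfimaConst, hG1, hs1, h0, hG3, show 1 - 2 * (H - 1 / 2) = 1 - (2 * H - 1) by ring, inv_div]
  have e : 2 * V * H * ((2 * H - 1) * Real.Gamma (2 * H - 1)) * Real.sin (H * Real.pi) *
      (-Real.cos (H * Real.pi) / Real.pi * Real.Gamma (1 - (2 * H - 1))) =
      V * H * (2 * H - 1) * (Real.Gamma (2 * H - 1) * Real.Gamma (1 - (2 * H - 1)) *
        -(2 * Real.sin (H * Real.pi) * Real.cos (H * Real.pi))) / Real.pi := by ring
  rw [e, hG2]
  field_simp

end FracDiff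

theorem mainTheorem4 {Ω : Type*} [MeasurableSpace Ω] (P : Measure Ω) [IsProbabilityMeasure P]
    (H : ℝ) (hH : H ∈ Set.Ioo (1 / 2 : ℝ) 1)
    (h : ℝ → ℝ)
    (h_pos : ∀ x ∈ Set.Icc (-1 / 2 : ℝ) (1 / 2), 0 < h x)
    (h_smooth : ContDiffOn ℝ 3 h (Set.Icc (-1 / 2 : ℝ) (1 / 2)))
    (h_match : derivWithin h (Set.Icc (-1 / 2 : ℝ) (1 / 2)) (-1 / 2) =
      derivWithin h (Set.Icc (-1 / 2 : ℝ) (1 / 2)) (1 / 2))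
    (Y X : ℤ → Ω → ℝ)
    (hY : FracDiff.SecondOrderStationary Y P)
    (hYh : FracDiff.HasSpectralDensity (FracDiff.acvf Y P) h)
    (hX : FracDiff.IsFractionalDifference (-(H - 1 / 2)) Y X P)
    (V : ℝ) (hV : 0 < V) (hc : FracDiff.cf H h = FracDiff.cfStar H V) :
    FracDiff.SecondOrderStationary X P ∧
      (fun n : ℕ => FracDiff.acvf X P n - FracDiff.fgnACVF H V n) =O[atTop]
        (fun n : ℕ => (n : ℝ) ^ (2 * H - 4)) := by
  have hd : 0 < H - 1 / 2 := by linarith [hH.1]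
  have hd1 : H - 1 / 2 < 1 / 2 := by linarith [hH.2]
  have hcont := h_smooth.continuousOn
  obtain ⟨⟨C, hC⟩, hs2⟩ := hYh.decay h_smooth h_match
  have hs := FracDiff.HasSpectralDensity.summable_abs hs2
  obtain ⟨B, hB⟩ := FracDiff.exists_convolution_bound hd hd1 (hYh.neg_eq hcont) hC hs2 hs
  refine ⟨hX.secondOrderStationary hY, ?_⟩
  -- The convolution bound with `d = H - 1/2`, where `∑ γ = h 0` and the matched constants turn the
  -- leading term into that of the fractional Gaussian noise.
  have h1 : (fun n : ℕ => FracDiff.acvf X P n - V * H * (2 * H - 1) * (n : ℝ) ^ (2 * H - 2))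
      =O[atTop] fun n : ℕ => (n : ℝ) ^ (2 * H - 4) := by
    refine IsBigO.of_bound B ?_
    filter_upwards [eventually_ge_atTop 1] with n hn
    have h2 := hB n hn
    rw [(hYh.hasSum hcont hs.of_abs).tsum_eq, ← mul_assoc, FracDiff.mul_arfimaConst_eq hH hc,
      ← FracDiff.acvf_eq_tsum hd hd1 hX hY hs, show 2 * (H - 1 / 2) - 1 = 2 * H - 2 by ring,
      show 2 * (H - 1 / 2) - 3 = 2 * H - 4 by ring] at h2
    rwa [Real.norm_eq_abs, Real.norm_of_nonneg (by positivity)]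
  refine (h1.sub (FracDiff.fgnACVF_isBigO H V)).congr_left fun n => ?_
  ring
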